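/- Let $\mathfrak H$ be a complex Hilbert space and $\mathcal A(\mathfrak H)$ the C*-algebra generated by the annihilation operators $a(f)$, $f\in\mathfrak H$ (antilinear in $f$), subject to $\{a(f),a(g)\}=0$ and $\{a(f),a^*(g)\}=\langle f,g\rangle$. Let $U$ be a unitary on $\mathfrak H$, and let $\Theta$ be the automorphism of $\mathcal A(\mathfrak H)$ with $\Theta(a(f))=a(Uf)$. Let $0\le\kappa\le1$ and let $\omega_\kappa$ be the gauge-invariant quasi-free state with symbol $\kappa\mathbf 1$, that is, $$\omega_\kappa\bigl(a^*(f_1)\cdots a^*(f_n)a(g_m)\cdots a(g_1)\bigr)=\delta_{nm}\det\bigl(\langle g_i,\kappa f_j\rangle\bigr).$$ Let $\mathfrak X=(x_1,\dots,x_n)$ be elements of $\mathcal A(\mathfrak H)$ with $\sum_j x_j^*x_j=\mathbf 1$ such that the completely positive map $\Lambda(y)=\sum_j x_j^*\,y\,x_j$ is quasi-free, determined by $(V,0)$: $V$ is a bounded operator on $\mathfrak H$ with $V^*V\le\mathbf 1$, and $$\Lambda\bigl(a^*(f_1)\cdots a^*(f_n)a(g_m)\cdots a(g_1)\bigr)=a^*(Vf_1)\cdots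 a^*(Vf_n)a(Vg_m)\cdots a(Vg_1)$$ for all $n,m\ge 0$ and all $f_i,g_j\in\mathfrak H$. Assume that the trap is local, i.e. $\mathbf 1-V^*V$ has finite rank. For $t\ge0$ let $\mathfrak X_t$ be the family of all products $\Theta^{t-1}(x_{j_{t-1}})\cdots\Theta(x_{j_1})\,x_{j_0}$ (with $\mathfrak X_0=(\mathbf 1)$), and put $V_t=(VU)^tU^{-t}$. For a finite family $\mathfrak Y=(y_i)$ with $\sum_i y_i^*y_i=\mathbf 1$ let $\mathsf H[\omega,\mathfrak Y]=\operatorname{Tr}\eta(\rho)$ with $\rho=[\omega(y_j^*y_i)]_{i,j}$, where $\eta(r)=-r\log r$ and $\eta(0)=0$. Then, for every $t\ge0$, $\mathfrak X_t$ again satisfies $\sum_i y_i^*y_i=\mathbf 1$ (the sum running over its members $y_i$), and its completely positive map $\Lambda_t(y)=\sum_i y_i^*\,y\,y_i$ is quasi-free, determined by $(V_t,0)$. The operator $\mathbf 1-V_t^*V_t$ has finite rank, and the expected number of particles absorbed by the trap up to time $t$ is $$\sum_i\omega_\kappa\bigl(a^*(e_i)a(e_i)-\Lambda_t(a^*(e_i)a(e_i))\bigr)=\kappa\operatorname{Tr}(\mathbf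 1-V_t^*V_t)$$ for every orthonormal basis $(e_i)$ of $\mathfrak H$. Moreover $$\mathsf H[\omega_\kappa,\mathfrak X_t]\ \ge\ \bigl(\eta(\kappa)+\eta(1-\kappa)\bigr)\operatorname{Tr}(\mathbf 1-V_t^*V_t).$$ -/

import Mathlib

namespace Fermion

open scoped InnerProductSpace

/-- The antisymmetric Fock space over a one-particle space with a (linearly ordered) orthonormal
basis `(e_i)_{i ∈ ι}`, in its occupation number realisation: the basis vector labelled by the finite
set `S = {i₁ < ⋯ < iₙ}` is `a*(e_{i₁}) ⋯ a*(e_{iₙ}) Ω`, and `S = ∅` is the vacuum `Ω`. -/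
abbrev FockSpace (ι : Type*) : Type _ := lp (fun _ : Finset ι => ℂ) 2

/-- The sign `(-1) ^ #{j ∈ S | j < i}`. -/
def fermiSign {ι : Type*} [LinearOrder ι] (i : ι) (S : Finset ι) : ℂ :=
  ∏ j ∈ S, if j < i then -1 else 1

theorem fermiSign_mul_self {ι : Type*} [LinearOrder ι] (i : ι) (S : Finset ι) :
    fermiSign i S * fermiSign i S = 1 := by
  rw [fermiSign, ← Finset.prod_mul_distrib]
  exact Finset.prod_eq_one fun j _ => by split_ifs <;> simp

theorem norm_fermiSign {ι : Type*} [LinearOrder ι] (i : ι) (S : Finset ι) :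
    ‖fermiSign i S‖ = 1 := by
  rw [fermiSign, norm_prod]
  exact Finset.prod_eq_one fun j _ => by split_ifs <;> simp

theorem conj_fermiSign {ι : Type*} [LinearOrder ι] (i : ι) (S : Finset ι) :
    (starRingEnd ℂ) (fermiSign i S) = fermiSign i S := by
  rw [fermiSign, map_prod]
  exact Finset.prod_congr rfl fun j _ => by split_ifs <;> simp

theorem fermiSign_insert {ι : Type*} [LinearOrder ι] (i j : ι) (S : Finset ι) (hj : j ∉ S) :
    fermiSign i (insert j S) = (if j < i then -1 else 1) * fermiSign i S := by
  rw [fermiSign, Finset.prod_insert hj, fermiSign]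

theorem memℓp_createFun {ι : Type*} [LinearOrder ι] (i : ι) (ψ : FockSpace ι) (T : Finset (Finset ι)) :
    ∑ S ∈ T, ‖(if i ∈ S then fermiSign i S * ψ (S.erase i) else 0 : ℂ)‖ ^ (2 : ENNReal).toReal
      ≤ ‖ψ‖ ^ (2 : ENNReal).toReal := by
  have h2 : (0 : ℝ) < (2 : ENNReal).toReal := by norm_num
  calc _ = ∑ S ∈ T with i ∈ S, ‖ψ (S.erase i)‖ ^ (2 : ENNReal).toReal := by
        rw [Finset.sum_filter]
        refine Finset.sum_congr rfl fun S _ => ?_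
        split_ifs
        · rw [norm_mul, norm_fermiSign, one_mul]
        · rw [norm_zero, Real.zero_rpow h2.ne']
    _ = ∑ S ∈ (T.filter (i ∈ ·)).image (·.erase i), ‖ψ S‖ ^ (2 : ENNReal).toReal := by
        rw [Finset.sum_image]
        intro S hS S' hS' h
        simp only [Finset.coe_filter, Set.mem_ofPred_eq] at hS hS'
        rw [← Finset.insert_erase hS.2, ← Finset.insert_erase hS'.2]
        exact congrArg (insert i) h
    _ ≤ _ := lp.sum_rpow_le_norm_rpow h2 ψ _

/-- The creation operator `a*(e_i)` of the `i`-th basis mode. -/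
noncomputable def createMode {ι : Type*} [LinearOrder ι] (i : ι) :
    FockSpace ι →L[ℂ] FockSpace ι :=
  LinearMap.mkContinuous
    { toFun := fun ψ => ⟨fun S => if i ∈ S then fermiSign i S * ψ (S.erase i) else 0,
        memℓp_gen' (memℓp_createFun i ψ)⟩
      map_add' := fun φ ψ => by
        ext S
        change (if i ∈ S then fermiSign i S * (φ + ψ : FockSpace ι) (S.erase i) else 0) =
          (if i ∈ S then fermiSign i S * φ (S.erase i) else 0) +
            (if i ∈ S then fermiSign i S * ψ (S.erase i) else 0)
        split_ifs
        · rw [lp.coeFn_add, Pi.add_apply, mul_add]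
        · rw [add_zero]
      map_smul' := fun c ψ => by
        ext S
        by_cases h : i ∈ S <;> simp [h, mul_left_comm] }
    1
    fun ψ => by
      have h2 : (0 : ℝ) < (2 : ENNReal).toReal := by norm_num
      rw [one_mul]
      exact lp.norm_le_of_forall_sum_le h2 (norm_nonneg _) (memℓp_createFun i ψ)

theorem createMode_apply {ι : Type*} [LinearOrder ι] (i : ι) (ψ : FockSpace ι) (S : Finset ι) :
    createMode i ψ S = if i ∈ S then fermiSign i S * ψ (S.erase i) else 0 := rfl

theorem star_createMode_apply {ι : Type*} [LinearOrder ι] (i : ι) (ψ : FockSpace ι)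
    (S : Finset ι) :
    (star (createMode i)) ψ S = if i ∈ S then 0 else fermiSign i S * ψ (insert i S) := by
  have h : ⟪lp.single 2 S (1 : ℂ), (star (createMode i)) ψ⟫_ℂ =
      ⟪createMode i (lp.single 2 S (1 : ℂ)), ψ⟫_ℂ := by
    rw [ContinuousLinearMap.star_eq_adjoint, ContinuousLinearMap.adjoint_inner_right]
  rw [lp.inner_single_left] at h
  have e : createMode i (lp.single 2 S (1 : ℂ)) =
      lp.single 2 (insert i S) (if i ∈ S then 0 else fermiSign i S) := by
    ext R
    rw [createMode_apply]
    by_cases hR : R = insert i S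
    · subst hR
      by_cases hS : i ∈ S
      · rw [Finset.insert_eq_of_mem hS, if_pos hS, if_pos hS, lp.single_apply_ne]
        · simp
        · intro h'
          rw [← h'] at hS
          exact Finset.notMem_erase i S hS
      · simp [hS, fermiSign_insert]
    · rw [lp.single_apply_ne _ _ _ hR]
      split_ifs with hi
      · rw [lp.single_apply_ne, mul_zero]
        exact fun h' => hR (by rw [← h', Finset.insert_erase hi])
      · rfl
  rw [e, lp.inner_single_left] at h
  simp only [RCLike.inner_apply, map_one, mul_one] at h
  rw [h]
  split_ifs
  · simp
  · rw [conj_fermiSign, mul_comm]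

theorem createMode_anticomm {ι : Type*} [LinearOrder ι] (i j : ι) :
    createMode i * createMode j + createMode j * createMode i = 0 := by
  ext ψ S
  simp only [add_apply, mul_apply_eq_comp, lp.coeFn_add,
    Pi.add_apply, createMode_apply, Finset.mem_erase, zero_apply,
    lp.coeFn_zero, Pi.zero_apply]
  by_cases hij : i = j
  · subst hij; simp
  by_cases hi : i ∈ S
  swap
  · simp [hi]
  by_cases hj : j ∈ S
  swap
  · simp [hj]
  have h1 := fermiSign_insert i j (S.erase j) (Finset.notMem_erase _ _)
  have h2 := fermiSign_insert j i (S.erase i) (Finset.notMem_erase _ _)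
  rw [Finset.insert_erase hj] at h1
  rw [Finset.insert_erase hi] at h2
  simp only [hi, hj, hij, Ne.symm hij, ne_eq, not_false_eq_true, and_self, if_true, h1, h2,
    Finset.erase_right_comm (a := j) (b := i)]
  rcases lt_or_gt_of_ne hij with h | h
  · simp only [h, h.not_gt, if_true, if_false]; ring
  · simp only [h, h.not_gt, if_true, if_false]; ring

theorem star_createMode_anticomm {ι : Type*} [LinearOrder ι] (i j : ι) :
    star (createMode i) * createMode j + createMode j * star (createMode i) =
      if i = j then 1 else 0 := by
  ext ψ S
  simp only [add_apply, mul_apply_eq_comp, lp.coeFn_add,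
    Pi.add_apply, createMode_apply, star_createMode_apply, Finset.mem_insert, Finset.mem_erase]
  by_cases hij : i = j
  · subst hij
    by_cases hi : i ∈ S
    · have h1 := fermiSign_insert i i (S.erase i) (Finset.notMem_erase _ _)
      rw [Finset.insert_erase hi] at h1
      simp [hi, h1, ← mul_assoc, fermiSign_mul_self]
    · simp [hi, fermiSign_insert, ← mul_assoc, fermiSign_mul_self]
  · by_cases hi : i ∈ S
    · simp [hi, hij]
    · by_cases hj : j ∈ S
      · have h1 := fermiSign_insert i j (S.erase j) (Finset.notMem_erase _ _)
        rw [Finset.insert_erase hj] at h1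
        have h2 := fermiSign_insert j i S hi
        simp only [hi, hj, hij, Ne.symm hij, if_true, if_false, or_true, and_false,
          h1, h2, Finset.erase_insert_of_ne hij, zero_apply,
          lp.coeFn_zero, Pi.zero_apply]
        rcases lt_or_gt_of_ne hij with h | h
        · simp only [h, h.not_gt, if_true, if_false]; ring
        · simp only [h, h.not_gt, if_true, if_false]; ring
      · simp [hi, hij, hj, Ne.symm hij]

section
variable {H : Type*} [NormedAddCommGroup H] [InnerProductSpace ℂ H] {ι : Type*} [LinearOrder ι]

/-- The annihilation operator `a(f)`: the adjoint of `a*(f) = ∑ i, ⟨e_i, f⟩ a*(e_i)`, a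
norm-convergent sum over the orthonormal basis `b = (e_i)`. -/
noncomputable def fockAnnihilation (b : HilbertBasis ι ℂ H) (f : H) :
    FockSpace ι →L[ℂ] FockSpace ι :=
  star (∑' i, b.repr f i • createMode i)

theorem norm_sum_createMode_sq_le (c : ι → ℂ) (T : Finset ι) :
    ‖∑ i ∈ T, c i • createMode i‖ ^ 2 ≤ ∑ i ∈ T, ‖c i‖ ^ 2 := by
  set A := ∑ i ∈ T, c i • createMode i with hA
  have hs : star A = ∑ i ∈ T, (starRingEnd ℂ) (c i) • star (createMode i) := by
    rw [hA, star_sum]; exact Finset.sum_congr rfl fun i _ => by rw [star_smul]; rfl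
  have key : star A * A + A * star A = ((∑ i ∈ T, ‖c i‖ ^ 2 : ℝ) : ℂ) • 1 := by
    rw [hs, hA, Finset.sum_mul_sum, Finset.sum_mul_sum, Finset.sum_comm (s := T) (t := T)
      (f := fun i j => c i • createMode i * (starRingEnd ℂ) (c j) • star (createMode j)),
      ← Finset.sum_add_distrib]
    simp_rw [← Finset.sum_add_distrib, smul_mul_smul_comm]
    simp_rw [mul_comm (c _) ((starRingEnd ℂ) _), ← smul_add, star_createMode_anticomm]
    rw [Complex.ofReal_sum, Finset.sum_smul]
    refine Finset.sum_congr rfl fun i hi => ?_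
    rw [Finset.sum_eq_single_of_mem i hi]
    · rw [if_pos rfl, mul_comm, Complex.mul_conj, Complex.normSq_eq_norm_sq]
    · intro j _ hj; rw [if_neg (Ne.symm hj), smul_zero]
  have hn : 0 ≤ ∑ i ∈ T, ‖c i‖ ^ 2 := Finset.sum_nonneg fun i _ => sq_nonneg _
  have : ‖A‖ ≤ √(∑ i ∈ T, ‖c i‖ ^ 2) := by
    refine ContinuousLinearMap.opNorm_le_bound _ (Real.sqrt_nonneg _) fun ψ => ?_
    refine le_of_sq_le_sq ?_ (by positivity)
    rw [mul_pow, Real.sq_sqrt hn]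
    have h := congrArg (fun B : FockSpace ι →L[ℂ] FockSpace ι => (⟪ψ, B ψ⟫_ℂ).re) key
    simp only [add_apply, mul_apply_eq_comp, inner_add_right,
      ContinuousLinearMap.star_eq_adjoint, ContinuousLinearMap.adjoint_inner_right,
      smul_apply, one_apply_eq_self, inner_smul_right,
      Complex.add_re] at h
    rw [← ContinuousLinearMap.adjoint_inner_left A _ ψ, Complex.re_ofReal_mul] at h
    have e : ∀ φ : FockSpace ι, (⟪φ, φ⟫_ℂ).re = ‖φ‖ ^ 2 := inner_self_eq_norm_sq (𝕜 := ℂ)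
    rw [e, e, e] at h
    linarith [sq_nonneg ‖(ContinuousLinearMap.adjoint A) ψ‖]
  calc ‖A‖ ^ 2 ≤ √(∑ i ∈ T, ‖c i‖ ^ 2) ^ 2 := by gcongr
    _ = _ := Real.sq_sqrt hn

theorem summable_createMode (b : HilbertBasis ι ℂ H) (f : H) :
    Summable fun i => b.repr f i • (createMode i : FockSpace ι →L[ℂ] FockSpace ι) := by
  have hs : Summable fun i => ‖b.repr f i‖ ^ 2 := by
    have := (lp.memℓp (b.repr f)).summable (by norm_num)
    simpa using this
  rw [summable_iff_vanishing_norm]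
  intro ε hε
  obtain ⟨s, h⟩ := summable_iff_vanishing_norm.1 hs (ε ^ 2) (by positivity)
  refine ⟨s, fun t ht => ?_⟩
  have h1 := h t ht
  rw [Real.norm_of_nonneg (Finset.sum_nonneg fun i _ => sq_nonneg _)] at h1
  exact lt_of_pow_lt_pow_left₀ 2 hε.le ((norm_sum_createMode_sq_le _ t).trans_lt h1)

theorem fockAnnihilation_add_smul (b : HilbertBasis ι ℂ H) (f g : H) (α : ℂ) :
    fockAnnihilation b (f + α • g) =
      fockAnnihilation b f + (starRingEnd ℂ) α • fockAnnihilation b g := by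
  have h : ∀ i, b.repr (f + α • g) i • (createMode i : FockSpace ι →L[ℂ] FockSpace ι) =
      b.repr f i • createMode i + α • (b.repr g i • createMode i) := fun i => by
    rw [map_add, map_smul, lp.coeFn_add, lp.coeFn_smul, Pi.add_apply, Pi.smul_apply, add_smul,
      smul_assoc]
  rw [fockAnnihilation, tsum_congr h, (summable_createMode b f).tsum_add
    ((summable_createMode b g).const_smul α), (summable_createMode b g).tsum_const_smul,
    star_add, star_smul]
  rfl

/-- The first canonical anticommutation relation `{a(f), a(g)} = 0`. -/
theorem fockAnnihilation_anticomm (b : HilbertBasis ι ℂ H) (f g : H) :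
    fockAnnihilation b f * fockAnnihilation b g +
      fockAnnihilation b g * fockAnnihilation b f = 0 := by
  rw [fockAnnihilation, fockAnnihilation, ← star_mul, ← star_mul, ← star_add, star_eq_zero,
    ← (summable_createMode b f).tsum_mul_left, ← (summable_createMode b f).tsum_mul_right,
    ← Summable.tsum_add ((summable_createMode b f).mul_left _)
      ((summable_createMode b f).mul_right _)]
  refine (tsum_congr fun i => ?_).trans tsum_zero
  rw [← (summable_createMode b g).tsum_mul_left, ← (summable_createMode b g).tsum_mul_right,
    ← Summable.tsum_add ((summable_createMode b g).mul_right _)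
      ((summable_createMode b g).mul_left _)]
  refine (tsum_congr fun j => ?_).trans tsum_zero
  rw [smul_mul_smul_comm, smul_mul_smul_comm, mul_comm (b.repr g j), ← smul_add,
    createMode_anticomm, smul_zero]

/-- The second canonical anticommutation relation `{a(f), a*(g)} = ⟨f, g⟩`. -/
theorem fockAnnihilation_star_anticomm (b : HilbertBasis ι ℂ H) (f g : H) :
    fockAnnihilation b f * star (fockAnnihilation b g) +
      star (fockAnnihilation b g) * fockAnnihilation b f = ⟪f, g⟫_ℂ • 1 := by
  have hf : Summable fun i => star (b.repr f i • (createMode i : FockSpace ι →L[ℂ] FockSpace ι)) :=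
    (summable_createMode b f).star
  rw [fockAnnihilation, fockAnnihilation, star_star, tsum_star,
    ← hf.tsum_mul_left, ← hf.tsum_mul_right,
    ← Summable.tsum_add (hf.mul_right _) (hf.mul_left _)]
  have key : ∀ i, star (b.repr f i • (createMode i : FockSpace ι →L[ℂ] FockSpace ι)) *
      (∑' j, b.repr g j • createMode j) + (∑' j, b.repr g j • createMode j) *
      star (b.repr f i • (createMode i : FockSpace ι →L[ℂ] FockSpace ι)) =
      (⟪f, b i⟫_ℂ * ⟪b i, g⟫_ℂ) • 1 := fun i => by
    rw [← (summable_createMode b g).tsum_mul_left, ← (summable_createMode b g).tsum_mul_right,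
      ← Summable.tsum_add ((summable_createMode b g).mul_left _)
        ((summable_createMode b g).mul_right _)]
    have h : ∀ j, star (b.repr f i • (createMode i : FockSpace ι →L[ℂ] FockSpace ι)) *
        b.repr g j • createMode j + b.repr g j • createMode j *
        star (b.repr f i • (createMode i : FockSpace ι →L[ℂ] FockSpace ι)) =
        if j = i then (⟪f, b i⟫_ℂ * ⟪b i, g⟫_ℂ) • 1 else 0 := fun j => by
      rw [star_smul, smul_mul_smul_comm, smul_mul_smul_comm, mul_comm (b.repr g j), ← smul_add,
        star_createMode_anticomm]
      by_cases hij : i = j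
      · subst hij
        rw [if_pos rfl, if_pos rfl, b.repr_apply_apply, b.repr_apply_apply,
          ← inner_conj_symm f (b i)]
        rfl
      · rw [if_neg hij, if_neg (Ne.symm hij), smul_zero]
    rw [tsum_congr h, tsum_ite_eq]
  rw [tsum_congr key, (b.summable_inner_mul_inner f g).tsum_smul_const, b.tsum_inner_mul_inner]

/-- The algebra `𝒜(H)` of the canonical anticommutation relations over `H`, represented on Fock
space: the C*-algebra generated by the annihilation operators `a(f)`, `f ∈ H`. -/
noncomputable def carAlgebra (b : HilbertBasis ι ℂ H) :
    StarSubalgebra ℂ (FockSpace ι →L[ℂ] FockSpace ι) :=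
  (StarAlgebra.adjoin ℂ (Set.range (fockAnnihilation b))).topologicalClosure

/-- The annihilation operator `a(f)` as an element of `𝒜(H)`; the creation operator `a*(f)` is
`star (annihilation b f)`. -/
noncomputable def annihilation (b : HilbertBasis ι ℂ H) (f : H) : carAlgebra b :=
  ⟨fockAnnihilation b f, StarSubalgebra.le_topologicalClosure _
    (StarAlgebra.subset_adjoin ℂ _ (Set.mem_range_self f))⟩

/-- The Wick-ordered monomial `a*(f₁) ⋯ a*(fₙ) a(gₘ) ⋯ a(g₁)`. -/
noncomputable def wickMonomial (b : HilbertBasis ι ℂ H) {n m : ℕ} (f : Fin n → H) (g : Fin m → H) :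
    carAlgebra b :=
  (List.ofFn fun j => star (annihilation b (f j))).prod *
    (List.ofFn fun j => annihilation b (g j.rev)).prod

/-- A state on a unital `*`-algebra: a normalised positive linear functional. -/
structure IsState {A : Type*} [Ring A] [StarRing A] [Algebra ℂ A] (ω : A →ₗ[ℂ] ℂ) : Prop where
  map_one : ω 1 = 1
  map_star_mul_self : ∀ y : A, 0 ≤ (ω (star y * y)).re ∧ (ω (star y * y)).im = 0

/-- `ω` is the gauge-invariant quasi-free state on `𝒜(H)` with symbol `Q`. -/
structure IsQuasiFreeState (b : HilbertBasis ι ℂ H) (Q : H →L[ℂ] H) (ω : carAlgebra b →ₗ[ℂ] ℂ) :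
    Prop extends IsState ω where
  map_wickMonomial : ∀ (n : ℕ) (f g : Fin n → H),
    ω (wickMonomial b f g) = (Matrix.of fun i j => ⟪g i, Q (f j)⟫_ℂ).det
  map_wickMonomial_of_ne : ∀ (n m : ℕ) (f : Fin n → H) (g : Fin m → H), n ≠ m →
    ω (wickMonomial b f g) = 0

/-- The map `Λ` on `𝒜(H)` is the gauge-invariant quasi-free map determined by `(V, 0)`. For `W = 0`
the only term of the defining sum over subsets that survives on a Wick-ordered monomial is the
full one, and the Wick-ordered monomials span a dense subspace of `𝒜(H)`. -/
structure IsQuasiFreeMap [CompleteSpace H] (b : HilbertBasis ι ℂ H) (V : H →L[ℂ] H)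
    (Λ : carAlgebra b →ₗ[ℂ] carAlgebra b) : Prop where
  star_mul_self_le_one : star V * V ≤ 1
  map_wickMonomial : ∀ (n m : ℕ) (f : Fin n → H) (g : Fin m → H),
    Λ (wickMonomial b f g) = wickMonomial b (fun i => V (f i)) (fun i => V (g i))

end

section
variable {A : Type*} [Ring A] [StarRing A] [Algebra ℂ A]

theorem IsState.map_star {ω : A →ₗ[ℂ] ℂ} [StarModule ℂ A] (hω : IsState ω) (y : A) :
    ω (star y) = (starRingEnd ℂ) (ω y) := by
  have h1 := (hω.map_star_mul_self (1 + y)).2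
  have h2 := (hω.map_star_mul_self (1 + Complex.I • y)).2
  have h0 := (hω.map_star_mul_self y).2
  have e2 : star (Complex.I • y) * (Complex.I • y) = star y * y := by
    rw [star_smul, smul_mul_smul_comm, Complex.star_def, Complex.conj_I, neg_mul, Complex.I_mul_I,
      neg_neg, one_smul]
  rw [star_add, star_one, add_mul, one_mul, mul_add, mul_one] at h1 h2
  rw [e2, star_smul] at h2
  simp only [map_add, map_smul, hω.map_one, Complex.add_im, smul_eq_mul, h0, Complex.one_im,
    Complex.star_def, Complex.conj_I, Complex.mul_im, Complex.I_re, Complex.I_im,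
    Complex.neg_re, Complex.neg_im] at h1 h2
  apply Complex.ext
  · rw [Complex.conj_re]; linarith
  · rw [Complex.conj_im]; linarith

/-- A finite family `(x_j)` with `∑ j, x_j* x_j = 1`. -/
def IsOperationalPartition {J : Type*} [Fintype J] (x : J → A) : Prop :=
  ∑ j, star (x j) * x j = 1

/-- The completely positive map `y ↦ ∑ j, x_j* y x_j`. -/
def partitionMap {J : Type*} [Fintype J] (x : J → A) : A →ₗ[ℂ] A :=
  ∑ j, LinearMap.mulLeftRight ℂ (star (x j), x j)

/-- The refinement `Θ^{t-1}(X) ∘ ⋯ ∘ Θ(X) ∘ X` of the partition `X = (x_j)`: its members are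
`Θ^{t-1}(x_{j_{t-1}}) ⋯ Θ(x_{j_1}) x_{j_0}`, labelled by `(j_0, …, j_{t-1})`. -/
def refinement {J : Type*} (Θ : A → A) (x : J → A) : (t : ℕ) → (Fin t → J) → A
  | 0, _ => 1
  | t + 1, j => Θ^[t] (x (j (Fin.last t))) * refinement Θ x t (Fin.init j)

/-- The correlation matrix `[ω(x_j* x_i)]_{i,j}`. -/
def correlationMatrix {J : Type*} (ω : A →ₗ[ℂ] ℂ) (x : J → A) : Matrix J J ℂ :=
  Matrix.of fun i j => ω (star (x j) * x i)

theorem IsState.isHermitian_correlationMatrix [StarModule ℂ A] {J : Type*} {ω : A →ₗ[ℂ] ℂ}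
    (hω : IsState ω) (x : J → A) : (correlationMatrix ω x).IsHermitian := by
  ext i j
  rw [Matrix.conjTranspose_apply, correlationMatrix, Matrix.of_apply, Matrix.of_apply,
    Complex.star_def, ← hω.map_star, star_mul, star_star]

/-- The von Neumann entropy `H[ω, X] = Tr η(ρ[X])` of the correlation matrix, i.e. the sum of
`η(r) = -r log r` over its eigenvalues `r`, with multiplicity. -/
noncomputable def partitionEntropy [StarModule ℂ A] {J : Type*} [Fintype J] [DecidableEq J]
    {ω : A →ₗ[ℂ] ℂ} (hω : IsState ω) (x : J → A) : ℝ :=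
  ∑ i, Real.negMulLog ((hω.isHermitian_correlationMatrix x).eigenvalues i)

end

/-- The trace of an operator of finite rank: the trace of its restriction to its range. -/
noncomputable def finiteRankTrace {H : Type*} [NormedAddCommGroup H] [InnerProductSpace ℂ H]
    (T : H →L[ℂ] H) : ℂ :=
  LinearMap.trace ℂ T.toLinearMap.range
    (T.toLinearMap.restrict fun _ _ => LinearMap.mem_range_self _ _)

/-- The operator `V_t = (V U)^t U^{-t}`. -/
noncomputable def trapOperator {H : Type*} [NormedAddCommGroup H] [InnerProductSpace ℂ H]
    [CompleteSpace H] (U : unitary (H →L[ℂ] H)) (V : H →L[ℂ] H) (t : ℕ) : H →L[ℂ] H :=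
  (V * (U : H →L[ℂ] H)) ^ t * ((U ^ t)⁻¹ : unitary (H →L[ℂ] H))

end Fermion

/-!
The proof rests on the commutation relations `a(f) x_j = x_j a(V f)` satisfied by the members of any
partition whose completely positive map `Λ` is quasi-free and determined by `(V, 0)`
(`annihilation_mul_kraus`): since `Λ` is multiplicative on `a*(f) a(f)`, the sum of the squares of
the differences is zero. As the maps of the refinements are again quasi-free, by
`Λ_{t+1} = Λ_t ∘ Θ^t ∘ Λ ∘ Θ^{-t}` (`partitionMap_refinement_succ`), it suffices to bound the entropy
of one partition of this kind, with `1 - V* V` of finite rank.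

If `H` is finite-dimensional, let `V f_k = v_k w_k` be a singular value decomposition. In the
occupation number bases of `(f_k)` and `(w_k)`, the commutation relations say that `x_j` keeps some
of the particles, with amplitudes `v_k`, and absorbs the others, the amplitude for absorbing exactly
`R` being `e_R(j) = ⟨Ω, x_j w_R⟩`. The vectors `e_R` are orthogonal with squared norms
`∏_{k ∈ R} (1 - v_k²)`, because of `∑ j, x_j* x_j = 1` (`sum_conj_absorption_mul`). The state has the
density matrix `κ^N (1 - κ)^(d - N)` (`IsQuasiFreeState.apply_eq_sum`), so that the `e_R` are
eigenvectors of the correlation matrix with the eigenvalues `∏_{k ∈ R} p_k ∏_{k ∉ R} (1 - p_k)`,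
`p_k = κ (1 - v_k²)` (`correlationMatrix_mulVec_absorption`). The entropy is therefore at least
`∑ k, (η(p_k) + η(1 - p_k))`, and the bound follows from the concavity of `p ↦ η(p) + η(1 - p)`.

If `H` is infinite-dimensional, then `1 - V* V = 0` and there is nothing to prove
(`one_sub_star_mul_self_eq_zero`). Each `x_j` is a norm limit of polynomials in finitely many modes,
so it nearly commutes, up to conjugation by the parity operator, with `a(g)` for `g` far away.
Comparing with `a(g) x_j = x_j a(V g)` shows that all the `x_j` are even and that `V` is close to `1`
far away. Even operators cannot absorb a single particle, so `V*` is isometric, and a coisometry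
which is a compact perturbation of the identity is unitary.
-/

namespace Fermion

open scoped InnerProductSpace

/-! ### Refinements of partitions and composition of quasi-free maps -/

section Refinement

variable {A : Type*} [Ring A] [StarRing A] [Algebra ℂ A]

theorem partitionMap_apply {J : Type*} [Fintype J] (x : J → A) (y : A) :
    partitionMap x y = ∑ j, star (x j) * y * x j := by
  simp [partitionMap, LinearMap.sum_apply, LinearMap.mulLeftRight_apply]

theorem isOperationalPartition_iff {J : Type*} [Fintype J] (x : J → A) :
    IsOperationalPartition x ↔ partitionMap x 1 = 1 := by
  simp [IsOperationalPartition, partitionMap_apply]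

theorem exists_starAlgEquiv_iterate (Θ : A ≃⋆ₐ[ℂ] A) (t : ℕ) :
    ∃ Φ : A ≃⋆ₐ[ℂ] A, ∀ y, Φ y = Θ^[t] y := by
  induction t with
  | zero => exact ⟨StarAlgEquiv.refl ℂ A, fun _ => rfl⟩
  | succ t ih =>
    obtain ⟨Φ, hΦ⟩ := ih
    exact ⟨Θ.trans Φ, fun y => by rw [Function.iterate_succ_apply, ← hΦ]; rfl⟩

/-- The completely positive maps of the refinements satisfy `Λ_{t+1} = Λ_t ∘ Θ^t ∘ Λ ∘ Θ^{-t}`. -/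
theorem partitionMap_refinement_succ {J : Type*} [Fintype J] (Θ : A → A) (x : J → A) (t : ℕ)
    (Φ : A ≃⋆ₐ[ℂ] A) (hΦ : ∀ y, Φ y = Θ^[t] y) (y : A) :
    partitionMap (refinement Θ x (t + 1)) y =
      partitionMap (refinement Θ x t) (Φ (partitionMap x (Φ.symm y))) := by
  rw [partitionMap_apply, ← (Fin.snocEquiv fun _ => J).sum_comp, Fintype.sum_prod_type_right,
    partitionMap_apply]
  refine Finset.sum_congr rfl fun r _ => ?_
  rw [partitionMap_apply, map_sum, Finset.mul_sum, Finset.sum_mul]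
  refine Finset.sum_congr rfl fun j _ => ?_
  have e : Fin.init (Fin.snocEquiv (fun _ => J) (j, r)) = r := Fin.init_snoc (α := fun _ => J) j r
  rw [refinement, e, Fin.snocEquiv_apply, Fin.snoc_last, map_mul, map_mul, map_star,
    StarAlgEquiv.apply_symm_apply, hΦ, star_mul]
  simp only [mul_assoc]

theorem isOperationalPartition_refinement {J : Type*} [Fintype J] (Θ : A ≃⋆ₐ[ℂ] A) {x : J → A}
    (hx : IsOperationalPartition x) (t : ℕ) : IsOperationalPartition (refinement Θ x t) := by
  rw [isOperationalPartition_iff] at *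
  induction t with
  | zero => simp [partitionMap_apply, refinement]
  | succ t ih =>
    obtain ⟨Φ, hΦ⟩ := exists_starAlgEquiv_iterate Θ t
    rw [partitionMap_refinement_succ Θ x t Φ hΦ, map_one, hx, map_one, ih]

theorem map_star_prod_mul_prod (Φ : A ≃⋆ₐ[ℂ] A) {n m : ℕ} (p : Fin n → A) (q : Fin m → A) :
    Φ ((List.ofFn fun j => star (p j)).prod * (List.ofFn q).prod) =
      (List.ofFn fun j => star (Φ (p j))).prod * (List.ofFn fun j => Φ (q j)).prod := by
  rw [map_mul, map_list_prod, map_list_prod, List.map_ofFn, List.map_ofFn]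
  simp only [Function.comp_def, map_star]

end Refinement

section QuasiFree

variable {H : Type*} [NormedAddCommGroup H] [InnerProductSpace ℂ H] {ι : Type*} [LinearOrder ι]

theorem map_wickMonomial_of_map_annihilation {b : HilbertBasis ι ℂ H}
    {Φ : carAlgebra b ≃⋆ₐ[ℂ] carAlgebra b} {W : H → H}
    (hΦ : ∀ f, Φ (annihilation b f) = annihilation b (W f)) {n m : ℕ} (f : Fin n → H)
    (g : Fin m → H) :
    Φ (wickMonomial b f g) = wickMonomial b (fun i => W (f i)) (fun i => W (g i)) := by
  rw [wickMonomial, map_star_prod_mul_prod]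
  simp only [wickMonomial, hΦ]

theorem wickMonomial_one_one (b : HilbertBasis ι ℂ H) (f g : H) :
    wickMonomial b (fun _ : Fin 1 => f) (fun _ : Fin 1 => g) =
      star (annihilation b f) * annihilation b g := by
  simp [wickMonomial]

theorem IsQuasiFreeState.map_star_mul {b : HilbertBasis ι ℂ H} {κ : ℝ}
    {ω : carAlgebra b →ₗ[ℂ] ℂ} (hω : IsQuasiFreeState b ((κ : ℂ) • 1) ω) (f g : H) :
    ω (star (annihilation b f) * annihilation b g) = κ * ⟪g, f⟫_ℂ := by
  rw [← wickMonomial_one_one, hω.map_wickMonomial, Matrix.det_fin_one]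
  simp

variable [CompleteSpace H]

theorem trapOperator_succ (U : unitary (H →L[ℂ] H)) (V : H →L[ℂ] H) (t : ℕ) :
    trapOperator U V (t + 1) = trapOperator U V t *
      ((U ^ t : unitary (H →L[ℂ] H)) * V * ((U ^ t)⁻¹ : unitary (H →L[ℂ] H))) := by
  have h1 : (((U ^ t)⁻¹ : unitary (H →L[ℂ] H)) : H →L[ℂ] H) *
      ((U ^ t : unitary (H →L[ℂ] H)) : H →L[ℂ] H) = 1 := by
    rw [← Submonoid.coe_mul, inv_mul_cancel, Submonoid.coe_one]
  have h2 : (U : H →L[ℂ] H) * (((U ^ (t + 1))⁻¹ : unitary (H →L[ℂ] H)) : H →L[ℂ] H) =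
      ((U ^ t)⁻¹ : unitary (H →L[ℂ] H)) := by
    rw [← Submonoid.coe_mul, pow_succ, mul_inv_rev, mul_inv_cancel_left]
  rw [trapOperator, trapOperator, pow_succ]
  simp only [mul_assoc]
  rw [h2, ← mul_assoc (((U ^ t)⁻¹ : unitary (H →L[ℂ] H)) : H →L[ℂ] H), h1, one_mul]

theorem trapOperator_zero (U : unitary (H →L[ℂ] H)) (V : H →L[ℂ] H) :
    trapOperator U V 0 = 1 := by
  simp [trapOperator]

theorem star_mul_self_mul_le_one {V W : H →L[ℂ] H} (hV : star V * V ≤ 1) (hW : star W * W ≤ 1) :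
    star (V * W) * (V * W) ≤ 1 := by
  have h := star_left_conjugate_le_conjugate hV W
  rw [mul_one] at h
  calc star (V * W) * (V * W) = star W * (star V * V) * W := by
        rw [star_mul]; simp only [mul_assoc]
    _ ≤ _ := h.trans hW

theorem star_conj_mul_self (u : unitary (H →L[ℂ] H)) (V : H →L[ℂ] H) :
    star ((u : H →L[ℂ] H) * V * ((u⁻¹ : unitary (H →L[ℂ] H)) : H →L[ℂ] H)) *
      ((u : H →L[ℂ] H) * V * ((u⁻¹ : unitary (H →L[ℂ] H)) : H →L[ℂ] H)) =
    u * (star V * V) * star (u : H →L[ℂ] H) := by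
  have hu : star (u : H →L[ℂ] H) * u = 1 := Unitary.coe_star_mul_self u
  have e : ((u⁻¹ : unitary (H →L[ℂ] H)) : H →L[ℂ] H) = star (u : H →L[ℂ] H) := rfl
  rw [e, star_mul, star_mul, star_star]
  simp only [mul_assoc]
  rw [← mul_assoc (star (u : H →L[ℂ] H)) (u : H →L[ℂ] H), hu, one_mul]

theorem star_conj_mul_self_le_one (u : unitary (H →L[ℂ] H)) {V : H →L[ℂ] H}
    (hV : star V * V ≤ 1) :
    star ((u : H →L[ℂ] H) * V * ((u⁻¹ : unitary (H →L[ℂ] H)) : H →L[ℂ] H)) *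
      ((u : H →L[ℂ] H) * V * ((u⁻¹ : unitary (H →L[ℂ] H)) : H →L[ℂ] H)) ≤ 1 := by
  rw [star_conj_mul_self]
  have h := star_right_conjugate_le_conjugate hV (u : H →L[ℂ] H)
  rwa [mul_one, (Unitary.mem_iff.1 u.2).2] at h

theorem isQuasiFreeMap_refinement {b : HilbertBasis ι ℂ H} {U : unitary (H →L[ℂ] H)}
    {Θ : carAlgebra b ≃⋆ₐ[ℂ] carAlgebra b}
    (hΘ : ∀ f : H, Θ (annihilation b f) = annihilation b ((U : H →L[ℂ] H) f))
    {J : Type*} [Fintype J] {x : J → carAlgebra b} {V : H →L[ℂ] H}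
    (hV : IsQuasiFreeMap b V (partitionMap x)) (t : ℕ) :
    IsQuasiFreeMap b (trapOperator U V t) (partitionMap (refinement Θ x t)) := by
  induction t with
  | zero =>
    refine ⟨by simp [trapOperator_zero], fun n m f g => ?_⟩
    simp [trapOperator_zero, partitionMap_apply, refinement]
  | succ t ih =>
    obtain ⟨Φ, hΦ⟩ := exists_starAlgEquiv_iterate Θ t
    have h1 : ∀ f, Φ (annihilation b f) =
        annihilation b (((U ^ t : unitary (H →L[ℂ] H)) : H →L[ℂ] H) f) := by
      intro f
      rw [hΦ]
      clear hΦ ih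
      induction t with
      | zero => simp
      | succ t ih => rw [Function.iterate_succ_apply', ih, hΘ, pow_succ']; rfl
    have h2 : ∀ f, Φ.symm (annihilation b f) =
        annihilation b ((((U ^ t)⁻¹ : unitary (H →L[ℂ] H)) : H →L[ℂ] H) f) := by
      intro f
      rw [StarAlgEquiv.symm_apply_eq, h1, ← mul_apply_eq_comp,
        ← Submonoid.coe_mul, mul_inv_cancel]
      rfl
    rw [trapOperator_succ]
    refine ⟨star_mul_self_mul_le_one ih.star_mul_self_le_one
      (star_conj_mul_self_le_one _ hV.star_mul_self_le_one), fun n m f g => ?_⟩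
    rw [partitionMap_refinement_succ Θ x t Φ hΦ, map_wickMonomial_of_map_annihilation h2,
      hV.map_wickMonomial, map_wickMonomial_of_map_annihilation h1, ih.map_wickMonomial]
    rfl

/-! ### Operators of finite rank -/

theorem finiteDimensional_range_trapOperator (U : unitary (H →L[ℂ] H)) {V : H →L[ℂ] H}
    (hloc : FiniteDimensional ℂ (1 - star V * V).toLinearMap.range) (t : ℕ) :
    FiniteDimensional ℂ
      (1 - star (trapOperator U V t) * trapOperator U V t).toLinearMap.range := by
  induction t with
  | zero =>
    rw [trapOperator_zero, star_one, one_mul, sub_self]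
    rw [ContinuousLinearMap.toLinearMap_zero, LinearMap.range_zero]
    exact finiteDimensional_bot ℂ H
  | succ t ih =>
    set W := trapOperator U V t
    set u := U ^ t
    set R := (u : H →L[ℂ] H) * V * ((u⁻¹ : unitary (H →L[ℂ] H)) : H →L[ℂ] H) with hR
    have e : 1 - star (trapOperator U V (t + 1)) * trapOperator U V (t + 1) =
        u * (1 - star V * V) * star (u : H →L[ℂ] H) + star R * (1 - star W * W) * R := by
      rw [trapOperator_succ]
      change 1 - star (W * R) * (W * R) = _
      rw [mul_sub, sub_mul, mul_one, (Unitary.mem_iff.1 u.2).2, ← star_conj_mul_self, ← hR,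
        star_mul, mul_sub, sub_mul]
      simp only [mul_assoc, mul_one]
      abel
    have key : ∀ (P Q S : H →L[ℂ] H), FiniteDimensional ℂ Q.toLinearMap.range →
        FiniteDimensional ℂ ((Q.toLinearMap.range).map P.toLinearMap) := fun P Q S h =>
      inferInstance
    have h1 := key u _ 1 hloc
    have h2 := key (star R) _ 1 ih
    have hle : (1 - star (trapOperator U V (t + 1)) *
        trapOperator U V (t + 1)).toLinearMap.range ≤
        ((1 - star V * V).toLinearMap.range).map (u : H →L[ℂ] H).toLinearMap ⊔
        ((1 - star W * W).toLinearMap.range).map (star R).toLinearMap := by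
      rw [e]
      rintro _ ⟨y, rfl⟩
      exact Submodule.add_mem_sup
        ⟨_, ⟨star (u : H →L[ℂ] H) y, rfl⟩, rfl⟩ ⟨_, ⟨R y, rfl⟩, rfl⟩
    exact Submodule.finiteDimensional_of_le hle

/-- For a self-adjoint operator of finite rank, the trace of the restriction to the range is the
sum of the diagonal matrix elements in any orthonormal basis. -/
theorem hasSum_inner_finiteRankTrace {κ : Type*} (b : HilbertBasis κ ℂ H) {T : H →L[ℂ] H}
    (hT : IsSelfAdjoint T) (hfin : FiniteDimensional ℂ T.toLinearMap.range) :
    HasSum (fun i => ⟪b i, T (b i)⟫_ℂ) (finiteRankTrace T) := by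
  have hsym : ∀ x y, ⟪T x, y⟫_ℂ = ⟪x, T y⟫_ℂ := hT.isSymmetric
  let u := stdOrthonormalBasis ℂ T.toLinearMap.range
  have h1 : finiteRankTrace T = ∑ k, ⟪(u k : H), T (u k)⟫_ℂ := by
    rw [finiteRankTrace, LinearMap.trace_eq_sum_inner _ u]
    rfl
  have h2 : ∀ i, ⟪b i, T (b i)⟫_ℂ = ∑ k, ⟪T (u k), b i⟫_ℂ * ⟪b i, (u k : H)⟫_ℂ := by
    intro i
    have := congrArg Subtype.val (u.sum_repr' ⟨T (b i), LinearMap.mem_range_self _ _⟩)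
    simp only [Submodule.coe_sum, Submodule.coe_smul, Submodule.coe_inner] at this
    rw [← this, inner_sum]
    refine Finset.sum_congr rfl fun k _ => ?_
    rw [inner_smul_right, hsym]
  rw [h1]
  simp_rw [h2]
  refine hasSum_sum fun k _ => ?_
  rw [← hsym]
  exact b.hasSum_inner_mul_inner _ _

theorem isSelfAdjoint_one_sub_star_mul_self (V : H →L[ℂ] H) :
    IsSelfAdjoint (1 - star V * V) :=
  (IsSelfAdjoint.one _).sub (IsSelfAdjoint.star_mul_self V)

theorem inner_one_sub_star_mul_self (V : H →L[ℂ] H) (f g : H) :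
    ⟪f, (1 - star V * V) g⟫_ℂ = ⟪f, g⟫_ℂ - ⟪V f, V g⟫_ℂ := by
  rw [sub_apply, inner_sub_right, mul_apply_eq_comp,
    ContinuousLinearMap.star_eq_adjoint, ContinuousLinearMap.adjoint_inner_right,
    one_apply_eq_self]

/-- The expected number of particles absorbed by a quasi-free map of finite rank. -/
theorem hasSum_absorbed {b : HilbertBasis ι ℂ H} {κ : ℝ} {ω : carAlgebra b →ₗ[ℂ] ℂ}
    (hω : IsQuasiFreeState b ((κ : ℂ) • 1) ω) {V : H →L[ℂ] H} {Λ : carAlgebra b →ₗ[ℂ] carAlgebra b}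
    (hΛ : IsQuasiFreeMap b V Λ)
    (hfin : FiniteDimensional ℂ (1 - star V * V).toLinearMap.range) :
    HasSum
      (fun i => ω (star (annihilation b (b i)) * annihilation b (b i) -
        Λ (star (annihilation b (b i)) * annihilation b (b i))))
      (κ * finiteRankTrace (1 - star V * V)) := by
  have h := (hasSum_inner_finiteRankTrace b (isSelfAdjoint_one_sub_star_mul_self V) hfin).mul_left
    (κ : ℂ)
  have e : ∀ i, ω (star (annihilation b (b i)) * annihilation b (b i) -
      Λ (star (annihilation b (b i)) * annihilation b (b i))) =
      κ * ⟪b i, (1 - star V * V) (b i)⟫_ℂ := fun i => by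
    rw [map_sub, ← wickMonomial_one_one, hΛ.map_wickMonomial, wickMonomial_one_one,
      wickMonomial_one_one, hω.map_star_mul, hω.map_star_mul, inner_one_sub_star_mul_self, mul_sub]
  simpa only [e] using h

end QuasiFree

/-! ### The Fock vacuum -/

section Vacuum

variable {H : Type*} [NormedAddCommGroup H] [InnerProductSpace ℂ H] {ι : Type*} [LinearOrder ι]

/-- The vacuum vector `Ω` of Fock space. -/
noncomputable def vacuum (ι : Type*) [LinearOrder ι] : FockSpace ι := lp.single 2 ∅ (1 : ℂ)

theorem norm_vacuum : ‖vacuum ι‖ = 1 := by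
  rw [vacuum, lp.norm_single (by norm_num), norm_one]

theorem inner_vacuum_vacuum : ⟪vacuum ι, vacuum ι⟫_ℂ = 1 := by
  rw [inner_self_eq_norm_sq_to_K, norm_vacuum]; simp

theorem inner_vacuum (ψ : FockSpace ι) : ⟪vacuum ι, ψ⟫_ℂ = ψ ∅ := by
  rw [vacuum, lp.inner_single_left]; simp

theorem fockAnnihilation_basis (b : HilbertBasis ι ℂ H) (i : ι) :
    fockAnnihilation b (b i) = star (createMode i) := by
  rw [fockAnnihilation, tsum_eq_single i]
  · rw [b.repr_self, lp.single_apply_self, one_smul]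
  · intro j hj
    rw [b.repr_self, lp.single_apply_ne _ _ _ hj, zero_smul]

theorem star_createMode_vacuum (i : ι) : star (createMode i) (vacuum ι) = 0 := by
  ext S
  rw [star_createMode_apply, vacuum, lp.single_apply_ne _ _ _ (Finset.insert_ne_empty i S)]
  simp

theorem fockAnnihilation_vacuum (b : HilbertBasis ι ℂ H) (f : H) :
    fockAnnihilation b f (vacuum ι) = 0 := by
  have hs : Summable fun i => star (b.repr f i • (createMode i : FockSpace ι →L[ℂ] FockSpace ι)) :=
    (summable_createMode b f).star
  have h := (ContinuousLinearMap.apply ℂ (FockSpace ι) (vacuum ι)).map_tsum hs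
  rw [ContinuousLinearMap.apply_apply] at h
  rw [fockAnnihilation, tsum_star, h]
  refine (tsum_congr fun i => ?_).trans tsum_zero
  rw [ContinuousLinearMap.apply_apply, star_smul, smul_apply, star_createMode_vacuum, smul_zero]

/-- The vacuum is, up to scalars, the only vector killed by all annihilation operators. -/
theorem eq_smul_vacuum (b : HilbertBasis ι ℂ H) {ψ : FockSpace ι}
    (h : ∀ f, fockAnnihilation b f ψ = 0) : ψ = ⟪vacuum ι, ψ⟫_ℂ • vacuum ι := by
  ext S
  rw [inner_vacuum, lp.coeFn_smul, Pi.smul_apply, vacuum]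
  rcases S.eq_empty_or_nonempty with rfl | ⟨i, hi⟩
  · simp
  · have hS : S ≠ ∅ := Finset.ne_empty_of_mem hi
    have h1 := congrArg (fun φ : FockSpace ι => φ (S.erase i)) (h (b i))
    simp only [fockAnnihilation_basis, star_createMode_apply, Finset.notMem_erase, if_false,
      Finset.insert_erase hi, lp.coeFn_zero, Pi.zero_apply, mul_eq_zero] at h1
    have h2 : fermiSign i (S.erase i) ≠ 0 := by
      rw [← norm_ne_zero_iff, norm_fermiSign]; exact one_ne_zero
    rw [lp.single_apply_ne _ _ _ hS, smul_zero]
    exact h1.resolve_left h2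

theorem inner_star_apply {E : Type*} [NormedAddCommGroup E] [InnerProductSpace ℂ E]
    [CompleteSpace E] (T : E →L[ℂ] E) (φ ψ : E) : ⟪(star T) φ, ψ⟫_ℂ = ⟪φ, T ψ⟫_ℂ := by
  rw [ContinuousLinearMap.star_eq_adjoint, ContinuousLinearMap.adjoint_inner_left]

theorem inner_apply_star {E : Type*} [NormedAddCommGroup E] [InnerProductSpace ℂ E]
    [CompleteSpace E] (T : E →L[ℂ] E) (φ ψ : E) : ⟪φ, (star T) ψ⟫_ℂ = ⟪T φ, ψ⟫_ℂ := by
  rw [ContinuousLinearMap.star_eq_adjoint, ContinuousLinearMap.adjoint_inner_right]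

theorem fockAnnihilation_star_apply (b : HilbertBasis ι ℂ H) (f g : H) (ψ : FockSpace ι) :
    fockAnnihilation b f (star (fockAnnihilation b g) ψ) =
      ⟪f, g⟫_ℂ • ψ - star (fockAnnihilation b g) (fockAnnihilation b f ψ) := by
  rw [eq_sub_iff_add_eq]
  exact congrArg (fun B : FockSpace ι →L[ℂ] FockSpace ι => B ψ)
    (fockAnnihilation_star_anticomm b f g)

theorem fockAnnihilation_star_vacuum (b : HilbertBasis ι ℂ H) (f g : H) :
    fockAnnihilation b f (star (fockAnnihilation b g) (vacuum ι)) = ⟪f, g⟫_ℂ • vacuum ι := by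
  rw [fockAnnihilation_star_apply, fockAnnihilation_vacuum, map_zero, sub_zero]

theorem norm_fockAnnihilation_apply_sq_add (b : HilbertBasis ι ℂ H) (f : H) (ψ : FockSpace ι) :
    ‖fockAnnihilation b f ψ‖ ^ 2 + ‖star (fockAnnihilation b f) ψ‖ ^ 2 = ‖f‖ ^ 2 * ‖ψ‖ ^ 2 := by
  have h := congrArg (fun B : FockSpace ι →L[ℂ] FockSpace ι => ⟪ψ, B ψ⟫_ℂ)
    (fockAnnihilation_star_anticomm b f f)
  simp only [add_apply, mul_apply_eq_comp, smul_apply, one_apply_eq_self, inner_add_right,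
    inner_smul_right, inner_apply_star] at h
  rw [← inner_star_apply] at h
  simp only [inner_self_eq_norm_sq_to_K] at h
  rw [add_comm]
  exact_mod_cast h

theorem norm_fockAnnihilation_le (b : HilbertBasis ι ℂ H) (f : H) :
    ‖fockAnnihilation b f‖ ≤ ‖f‖ := by
  refine ContinuousLinearMap.opNorm_le_bound _ (norm_nonneg _) fun ψ => ?_
  refine le_of_sq_le_sq ?_ (by positivity)
  nlinarith [norm_fockAnnihilation_apply_sq_add b f ψ, sq_nonneg ‖star (fockAnnihilation b f) ψ‖]

theorem norm_star_fockAnnihilation_vacuum (b : HilbertBasis ι ℂ H) (f : H) :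
    ‖star (fockAnnihilation b f) (vacuum ι)‖ ^ 2 = ‖f‖ ^ 2 := by
  have h := norm_fockAnnihilation_apply_sq_add b f (vacuum ι)
  rw [fockAnnihilation_vacuum, norm_vacuum, norm_zero] at h
  linarith

end Vacuum

/-! ### Intertwining relations of the Kraus operators -/

section Intertwining

theorem sum_star_mul_intertwiner {A : Type*} [Ring A] [StarRing A] [Algebra ℂ A] {J : Type*}
    [Fintype J] (x : J → A) (a c : A) :
    ∑ j, star (a * x j - x j * c) * (a * x j - x j * c) =
      partitionMap x (star a * a) - partitionMap x (star a) * c - star c * partitionMap x a +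
        star c * partitionMap x 1 * c := by
  simp only [partitionMap_apply, Finset.sum_mul, Finset.mul_sum, ← Finset.sum_sub_distrib,
    ← Finset.sum_add_distrib]
  refine Finset.sum_congr rfl fun j _ => ?_
  rw [star_sub, star_mul, star_mul]
  noncomm_ring

theorem sum_norm_sq_apply {E : Type*} [NormedAddCommGroup E] [InnerProductSpace ℂ E]
    [CompleteSpace E] {J : Type*} [Fintype J] (x : J → E →L[ℂ] E) (ψ : E) :
    ((∑ j, ‖x j ψ‖ ^ 2 : ℝ) : ℂ) = ⟪ψ, (∑ j, star (x j) * x j) ψ⟫_ℂ := by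
  rw [sum_apply, inner_sum]
  push_cast
  refine Finset.sum_congr rfl fun j _ => ?_
  change _ = ⟪ψ, star (x j) (x j ψ)⟫_ℂ
  rw [inner_apply_star, inner_self_eq_norm_sq_to_K]
  rfl

theorem eq_zero_of_sum_star_mul_self {E : Type*} [NormedAddCommGroup E] [InnerProductSpace ℂ E]
    [CompleteSpace E] {J : Type*} [Fintype J] {x : J → E →L[ℂ] E}
    (h : ∑ j, star (x j) * x j = 0) (j : J) : x j = 0 := by
  ext ψ
  have h1 := sum_norm_sq_apply x ψ
  rw [h, zero_apply, inner_zero_right, Complex.ofReal_eq_zero,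
    Finset.sum_eq_zero_iff_of_nonneg fun _ _ => sq_nonneg _] at h1
  simpa using h1 j (Finset.mem_univ j)

variable {H : Type*} [NormedAddCommGroup H] [InnerProductSpace ℂ H] {ι : Type*} [LinearOrder ι]
  {b : HilbertBasis ι ℂ H}

theorem carAlgebra_eq_zero_of_sum {J : Type*} [Fintype J] {x : J → carAlgebra b}
    (h : ∑ j, star (x j) * x j = 0) (j : J) : x j = 0 := by
  have h1 := congrArg (Subtype.val : carAlgebra b → FockSpace ι →L[ℂ] FockSpace ι) h
  rw [AddSubmonoidClass.coe_finsetSum] at h1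
  exact Subtype.ext (eq_zero_of_sum_star_mul_self
    (x := fun j => (x j : FockSpace ι →L[ℂ] FockSpace ι)) h1 j)

theorem annihilation_star_anticomm (f g : H) :
    annihilation b f * star (annihilation b g) + star (annihilation b g) * annihilation b f =
      ⟪f, g⟫_ℂ • (1 : carAlgebra b) :=
  Subtype.ext (fockAnnihilation_star_anticomm b f g)

variable [CompleteSpace H] {J : Type*} [Fintype J] {x : J → carAlgebra b} {V : H →L[ℂ] H}

theorem IsQuasiFreeMap.map_annihilation {Λ : carAlgebra b →ₗ[ℂ] carAlgebra b}
    (hV : IsQuasiFreeMap b V Λ) (f : H) :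
    Λ (annihilation b f) = annihilation b (V f) := by
  have h := hV.map_wickMonomial 0 1 Fin.elim0 (fun _ => f)
  simpa [wickMonomial] using h

theorem IsQuasiFreeMap.map_star_annihilation {Λ : carAlgebra b →ₗ[ℂ] carAlgebra b}
    (hV : IsQuasiFreeMap b V Λ) (f : H) :
    Λ (star (annihilation b f)) = star (annihilation b (V f)) := by
  have h := hV.map_wickMonomial 1 0 (fun _ => f) Fin.elim0
  simpa [wickMonomial] using h

theorem IsQuasiFreeMap.map_star_mul {Λ : carAlgebra b →ₗ[ℂ] carAlgebra b}
    (hV : IsQuasiFreeMap b V Λ) (f g : H) :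
    Λ (star (annihilation b f) * annihilation b g) =
      star (annihilation b (V f)) * annihilation b (V g) := by
  rw [← wickMonomial_one_one, hV.map_wickMonomial, wickMonomial_one_one]

/-- The Kraus operators of a quasi-free map determined by `(V, 0)` satisfy `a(f) x_j = x_j a(V f)`:
the sum over `j` of the squares `|a(f) x_j - x_j a(V f)|²` vanishes, because
`Λ(a*(f) a(f)) = Λ(a(f))* Λ(a(f))`. -/
theorem annihilation_mul_kraus (hx : IsOperationalPartition x)
    (hV : IsQuasiFreeMap b V (partitionMap x)) (f : H) (j : J) :
    annihilation b f * x j = x j * annihilation b (V f) := by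
  rw [← sub_eq_zero]
  refine carAlgebra_eq_zero_of_sum
    (x := fun j => annihilation b f * x j - x j * annihilation b (V f)) ?_ j
  rw [sum_star_mul_intertwiner, hV.map_star_mul, hV.map_annihilation, hV.map_star_annihilation,
    (isOperationalPartition_iff x).1 hx, mul_one]
  abel

/-- On vectors on which `V` is isometric, the Kraus operators intertwine the creation operators
as well. -/
theorem star_annihilation_mul_kraus (hx : IsOperationalPartition x)
    (hV : IsQuasiFreeMap b V (partitionMap x)) {f : H} (hf : (1 - star V * V) f = 0) (j : J) :
    star (annihilation b f) * x j = x j * star (annihilation b (V f)) := by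
  rw [← sub_eq_zero]
  refine carAlgebra_eq_zero_of_sum
    (x := fun j => star (annihilation b f) * x j - x j * star (annihilation b (V f))) ?_ j
  have h1 : ⟪f, f⟫_ℂ = ⟪V f, V f⟫_ℂ := by
    rw [← sub_eq_zero, ← inner_one_sub_star_mul_self, hf, inner_zero_right]
  have h2 : partitionMap x (annihilation b f * star (annihilation b f)) =
      annihilation b (V f) * star (annihilation b (V f)) := by
    have h3 := annihilation_star_anticomm (b := b) f f
    have h4 := annihilation_star_anticomm (b := b) (V f) (V f)
    rw [eq_sub_of_add_eq h3, map_sub, hV.map_star_mul, map_smul,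
      (isOperationalPartition_iff x).1 hx, h1, eq_sub_of_add_eq h4]
  rw [sum_star_mul_intertwiner, star_star, star_star, h2, hV.map_annihilation,
    hV.map_star_annihilation, (isOperationalPartition_iff x).1 hx, mul_one]
  abel

omit [CompleteSpace H] in
theorem sum_norm_sq_kraus_apply (hx : IsOperationalPartition x) (ψ : FockSpace ι) :
    ∑ j, ‖(x j : FockSpace ι →L[ℂ] FockSpace ι) ψ‖ ^ 2 = ‖ψ‖ ^ 2 := by
  have h1 := congrArg (Subtype.val : carAlgebra b → FockSpace ι →L[ℂ] FockSpace ι) hx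
  rw [AddSubmonoidClass.coe_finsetSum] at h1
  have h := sum_norm_sq_apply (fun j => (x j : FockSpace ι →L[ℂ] FockSpace ι)) ψ
  rw [show (∑ j, star (x j : FockSpace ι →L[ℂ] FockSpace ι) * x j) = 1 from h1,
    one_apply_eq_self, inner_self_eq_norm_sq_to_K] at h
  refine Complex.ofReal_injective (h.trans ?_)
  rw [Complex.ofReal_pow]
  rfl

theorem fockAnnihilation_kraus_apply (hx : IsOperationalPartition x)
    (hV : IsQuasiFreeMap b V (partitionMap x)) (f : H) (j : J) (ψ : FockSpace ι) :
    fockAnnihilation b f ((x j : FockSpace ι →L[ℂ] FockSpace ι) ψ) =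
      (x j : FockSpace ι →L[ℂ] FockSpace ι) (fockAnnihilation b (V f) ψ) :=
  congrArg (fun y : carAlgebra b => (y : FockSpace ι →L[ℂ] FockSpace ι) ψ)
    (annihilation_mul_kraus hx hV f j)

theorem kraus_vacuum (hx : IsOperationalPartition x)
    (hV : IsQuasiFreeMap b V (partitionMap x)) (j : J) :
    (x j : FockSpace ι →L[ℂ] FockSpace ι) (vacuum ι) =
      ⟪vacuum ι, (x j : FockSpace ι →L[ℂ] FockSpace ι) (vacuum ι)⟫_ℂ • vacuum ι :=
  eq_smul_vacuum b fun f => by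
    rw [fockAnnihilation_kraus_apply hx hV, fockAnnihilation_vacuum, map_zero]

theorem sum_norm_sq_kraus_vacuum (hx : IsOperationalPartition x)
    (hV : IsQuasiFreeMap b V (partitionMap x)) :
    ∑ j, ‖⟪vacuum ι, (x j : FockSpace ι →L[ℂ] FockSpace ι) (vacuum ι)⟫_ℂ‖ ^ 2 = 1 := by
  have h := sum_norm_sq_kraus_apply hx (vacuum ι)
  rw [norm_vacuum, one_pow] at h
  rw [← h]
  refine Finset.sum_congr rfl fun j _ => ?_
  conv_rhs => rw [kraus_vacuum hx hV j, norm_smul, norm_vacuum, mul_one]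

/-- On a one-particle vector the Kraus operator `x_j` either keeps the particle, moving it by
`V*`, or absorbs it into the vacuum. -/
theorem kraus_oneParticle (hx : IsOperationalPartition x)
    (hV : IsQuasiFreeMap b V (partitionMap x)) (j : J) (h : H) :
    (x j : FockSpace ι →L[ℂ] FockSpace ι) (star (fockAnnihilation b h) (vacuum ι)) =
      ⟪vacuum ι, (x j : FockSpace ι →L[ℂ] FockSpace ι)
        (star (fockAnnihilation b h) (vacuum ι))⟫_ℂ • vacuum ι +
      ⟪vacuum ι, (x j : FockSpace ι →L[ℂ] FockSpace ι) (vacuum ι)⟫_ℂ •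
        star (fockAnnihilation b (star V h)) (vacuum ι) := by
  rw [← sub_eq_iff_eq_add]
  have h1 := eq_smul_vacuum b (ψ := (x j : FockSpace ι →L[ℂ] FockSpace ι)
    (star (fockAnnihilation b h) (vacuum ι)) -
      ⟪vacuum ι, (x j : FockSpace ι →L[ℂ] FockSpace ι) (vacuum ι)⟫_ℂ •
        star (fockAnnihilation b (star V h)) (vacuum ι)) fun f => by
    rw [map_sub, fockAnnihilation_kraus_apply hx hV, fockAnnihilation_star_vacuum, map_smul,
      map_smul, fockAnnihilation_star_vacuum, inner_apply_star]
    rw [kraus_vacuum hx hV j, inner_smul_right, inner_vacuum_vacuum, mul_one, smul_comm, sub_self]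
  rw [h1]
  congr 1
  rw [inner_sub_right, inner_smul_right, inner_apply_star, fockAnnihilation_vacuum,
    inner_zero_left, mul_zero, sub_zero]

/-- The probability that a particle in the state `h` is absorbed is `‖h‖² - ‖V* h‖²`. -/
theorem sum_norm_sq_absorbed (hx : IsOperationalPartition x)
    (hV : IsQuasiFreeMap b V (partitionMap x)) (h : H) :
    ∑ j, ‖⟪vacuum ι, (x j : FockSpace ι →L[ℂ] FockSpace ι)
        (star (fockAnnihilation b h) (vacuum ι))⟫_ℂ‖ ^ 2 + ‖star V h‖ ^ 2 = ‖h‖ ^ 2 := by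
  have h0 := sum_norm_sq_kraus_apply hx (star (fockAnnihilation b h) (vacuum ι))
  rw [norm_star_fockAnnihilation_vacuum] at h0
  rw [← h0, ← one_mul (‖star V h‖ ^ 2), ← sum_norm_sq_kraus_vacuum hx hV, Finset.sum_mul,
    ← Finset.sum_add_distrib]
  refine Finset.sum_congr rfl fun j _ => ?_
  conv_rhs => rw [kraus_oneParticle hx hV j h]
  rw [sq ‖_ + _‖, norm_add_sq_eq_norm_sq_add_norm_sq_of_inner_eq_zero (𝕜 := ℂ), ← sq, ← sq,
    norm_smul, norm_smul, norm_vacuum, mul_one, mul_pow, norm_star_fockAnnihilation_vacuum]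
  rw [inner_smul_left, inner_smul_right, inner_apply_star, fockAnnihilation_vacuum,
    inner_zero_left, mul_zero, mul_zero]

end Intertwining

/-! ### The parity of the particle number -/

section Parity

variable {ι : Type*} [LinearOrder ι]

omit [LinearOrder ι] in
theorem memℓp_parityFun (ψ : FockSpace ι) (T : Finset (Finset ι)) :
    ∑ S ∈ T, ‖((-1) ^ S.card * ψ S : ℂ)‖ ^ (2 : ENNReal).toReal ≤
      ‖ψ‖ ^ (2 : ENNReal).toReal := by
  have h2 : (0 : ℝ) < (2 : ENNReal).toReal := by norm_num
  simpa using lp.sum_rpow_le_norm_rpow h2 ψ T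

/-- The parity operator `(-1)^N` on Fock space, where `N` counts the particles. -/
noncomputable def parity (ι : Type*) [LinearOrder ι] : FockSpace ι →L[ℂ] FockSpace ι :=
  LinearMap.mkContinuous
    { toFun := fun ψ => ⟨fun S => (-1) ^ S.card * ψ S, memℓp_gen' (memℓp_parityFun ψ)⟩
      map_add' := fun φ ψ => by
        ext S
        exact mul_add _ _ _
      map_smul' := fun c ψ => by
        ext S
        exact mul_left_comm _ _ _ }
    1
    fun ψ => by
      have h2 : (0 : ℝ) < (2 : ENNReal).toReal := by norm_num
      rw [one_mul]
      exact lp.norm_le_of_forall_sum_le h2 (norm_nonneg _) (memℓp_parityFun ψ)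

theorem parity_apply (ψ : FockSpace ι) (S : Finset ι) :
    parity ι ψ S = (-1) ^ S.card * ψ S := rfl

theorem norm_parity_le : ‖parity ι‖ ≤ 1 :=
  LinearMap.mkContinuous_norm_le _ zero_le_one _

theorem parity_mul_parity : parity ι * parity ι = 1 := by
  ext ψ S
  rw [mul_apply_eq_comp, parity_apply, parity_apply, ← mul_assoc, ← mul_pow]
  simp

theorem star_parity : star (parity ι) = parity ι := by
  refine ContinuousLinearMap.ext fun ψ => ext_inner_left ℂ fun φ => ?_
  rw [inner_apply_star, lp.inner_eq_tsum, lp.inner_eq_tsum]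
  refine tsum_congr fun S => ?_
  rw [parity_apply, parity_apply, ← smul_eq_mul, ← smul_eq_mul, inner_smul_left, inner_smul_right]
  simp

theorem parity_vacuum : parity ι (vacuum ι) = vacuum ι := by
  ext S
  rw [parity_apply, vacuum]
  by_cases hS : S = ∅
  · subst hS; simp
  · rw [lp.single_apply_ne _ _ _ hS, mul_zero]

theorem parity_mul_createMode (i : ι) :
    parity ι * createMode i = -(createMode i * parity ι) := by
  ext ψ S
  rw [mul_apply_eq_comp, parity_apply, createMode_apply, neg_apply, lp.coeFn_neg, Pi.neg_apply,
    mul_apply_eq_comp, createMode_apply, parity_apply]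
  split_ifs with h
  · rw [← Finset.card_erase_add_one h, pow_succ]; ring
  · simp

variable {H : Type*} [NormedAddCommGroup H] [InnerProductSpace ℂ H] (b : HilbertBasis ι ℂ H)

theorem parity_mul_star_fockAnnihilation (f : H) :
    parity ι * star (fockAnnihilation b f) = -(star (fockAnnihilation b f) * parity ι) := by
  rw [fockAnnihilation, star_star, ← (summable_createMode b f).tsum_mul_left,
    ← (summable_createMode b f).tsum_mul_right, ← tsum_neg]
  refine tsum_congr fun i => ?_
  rw [mul_smul_comm, smul_mul_assoc, parity_mul_createMode, smul_neg]

theorem parity_mul_fockAnnihilation (f : H) :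
    parity ι * fockAnnihilation b f = -(fockAnnihilation b f * parity ι) := by
  have h := congrArg star (parity_mul_star_fockAnnihilation b f)
  rw [star_mul, star_neg, star_mul, star_star, star_parity] at h
  rw [h, neg_neg]

end Parity

/-! ### Elements of the algebra seen from far away -/

section Far

variable {H : Type*} [NormedAddCommGroup H] [InnerProductSpace ℂ H] {ι : Type*} [LinearOrder ι]
  (b : HilbertBasis ι ℂ H)

/-- Every polynomial `y` in the creation and annihilation operators only involves finitely many
one-particle vectors, so that `a(g) y = (θ y θ) a(g)`, with `θ` the parity, for all `g` orthogonal
to them. -/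
theorem far_commutation_of_mem_adjoin {y : FockSpace ι →L[ℂ] FockSpace ι}
    (hy : y ∈ StarAlgebra.adjoin ℂ (Set.range (fockAnnihilation b))) :
    ∃ K : Submodule ℂ H, FiniteDimensional ℂ K ∧ ∀ g ∈ Kᗮ,
      fockAnnihilation b g * y = parity ι * y * parity ι * fockAnnihilation b g ∧
      star (fockAnnihilation b g) * y = parity ι * y * parity ι * star (fockAnnihilation b g) := by
  have hP := parity_mul_parity (ι := ι)
  induction hy using StarAlgebra.adjoin_induction with
  | mem y hy =>
    obtain ⟨f, rfl⟩ := hy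
    refine ⟨ℂ ∙ f, inferInstance, fun g hg => ?_⟩
    have hfg : ⟪f, g⟫_ℂ = 0 := Submodule.mem_orthogonal_singleton_iff_inner_right.1 hg
    rw [parity_mul_fockAnnihilation, neg_mul, mul_assoc _ (parity ι), hP, mul_one, neg_mul,
      neg_mul]
    refine ⟨eq_neg_of_add_eq_zero_left (fockAnnihilation_anticomm b g f),
      eq_neg_of_add_eq_zero_right ?_⟩
    rw [fockAnnihilation_star_anticomm, hfg, zero_smul]
  | algebraMap r =>
    refine ⟨⊥, inferInstance, fun g _ => ?_⟩
    rw [Algebra.algebraMap_eq_smul_one]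
    simp [hP]
  | add y z _ _ hy hz =>
    obtain ⟨K, hK, h1⟩ := hy
    obtain ⟨L, hL, h2⟩ := hz
    refine ⟨K ⊔ L, inferInstance, fun g hg => ?_⟩
    have h1 := h1 g (Submodule.orthogonal_le le_sup_left hg)
    have h2 := h2 g (Submodule.orthogonal_le le_sup_right hg)
    simp only [mul_add, add_mul, h1.1, h1.2, h2.1, h2.2, and_self]
  | mul y z _ _ hy hz =>
    obtain ⟨K, hK, h1⟩ := hy
    obtain ⟨L, hL, h2⟩ := hz
    refine ⟨K ⊔ L, inferInstance, fun g hg => ?_⟩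
    have h1 := h1 g (Submodule.orthogonal_le le_sup_left hg)
    have h2 := h2 g (Submodule.orthogonal_le le_sup_right hg)
    have e : parity ι * (y * z) * parity ι =
        parity ι * y * parity ι * (parity ι * z * parity ι) := by
      simp only [mul_assoc]
      rw [← mul_assoc (parity ι) (parity ι), hP, one_mul]
    rw [e]
    constructor
    · rw [← mul_assoc, h1.1, mul_assoc, h2.1, ← mul_assoc]
    · rw [← mul_assoc, h1.2, mul_assoc, h2.2, ← mul_assoc]
  | star y _ hy =>
    obtain ⟨K, hK, h1⟩ := hy
    have key : ∀ a : FockSpace ι →L[ℂ] FockSpace ι, parity ι * a = -(a * parity ι) →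
        a * y = parity ι * y * parity ι * a →
        star a * star y = parity ι * star y * parity ι * star a := fun a ha h => by
      have h2 : y * a = a * (parity ι * y * parity ι) := by
        have h3 := congrArg (fun c => parity ι * c * parity ι) h
        simp only [mul_assoc, ha] at h3
        rw [← mul_assoc (parity ι) (parity ι), hP, one_mul, ← mul_assoc (parity ι) a, ha] at h3
        rw [neg_mul, neg_mul, mul_neg, neg_inj, mul_assoc a, mul_assoc a, hP, mul_one] at h3
        rw [← h3, mul_assoc]
      have h3 := congrArg star h2
      simp only [star_mul, star_parity] at h3
      rw [h3]; simp only [mul_assoc]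
    refine ⟨K, hK, fun g hg => ⟨?_, ?_⟩⟩
    · have := key _ (parity_mul_star_fockAnnihilation b g) (h1 g hg).2
      rwa [star_star] at this
    · exact key _ (parity_mul_fockAnnihilation b g) (h1 g hg).1

theorem norm_star_eq {E : Type*} [NormedAddCommGroup E] [InnerProductSpace ℂ E]
    [CompleteSpace E] (T : E →L[ℂ] E) : ‖star T‖ = ‖T‖ := by
  rw [ContinuousLinearMap.star_eq_adjoint, LinearIsometryEquiv.norm_map]

omit b in
theorem norm_parity_conj_le (y : FockSpace ι →L[ℂ] FockSpace ι) :
    ‖parity ι * y * parity ι‖ ≤ ‖y‖ := by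
  have h := norm_parity_le (ι := ι)
  calc ‖parity ι * y * parity ι‖ ≤ ‖parity ι‖ * ‖y‖ * ‖parity ι‖ :=
        (norm_mul_le _ _).trans (by gcongr; exact norm_mul_le _ _)
    _ ≤ 1 * ‖y‖ * 1 := by gcongr
    _ = ‖y‖ := by ring

/-- Every element of the algebra approximately commutes, up to the parity, with far away
annihilation and creation operators. -/
theorem far_commutation {y : FockSpace ι →L[ℂ] FockSpace ι} (hy : y ∈ carAlgebra b) {ε : ℝ}
    (hε : 0 < ε) :
    ∃ K : Submodule ℂ H, FiniteDimensional ℂ K ∧ ∀ g ∈ Kᗮ,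
      ‖fockAnnihilation b g * y - parity ι * y * parity ι * fockAnnihilation b g‖ ≤ ε * ‖g‖ ∧
      ‖star (fockAnnihilation b g) * y - parity ι * y * parity ι * star (fockAnnihilation b g)‖ ≤
        ε * ‖g‖ := by
  obtain ⟨z, hz, hyz⟩ := Metric.mem_closure_iff.1 hy (ε / 2) (by positivity)
  obtain ⟨K, hK, h⟩ := far_commutation_of_mem_adjoin b hz
  rw [dist_eq_norm] at hyz
  have key : ∀ (a : FockSpace ι →L[ℂ] FockSpace ι) (r : ℝ), ‖a‖ ≤ r →
      a * z = parity ι * z * parity ι * a → ‖a * y - parity ι * y * parity ι * a‖ ≤ ε * r := by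
    intro a r hr ha
    have hr0 : 0 ≤ r := (norm_nonneg a).trans hr
    have e : a * y - parity ι * y * parity ι * a =
        a * (y - z) - parity ι * (y - z) * parity ι * a := by
      simp only [mul_sub, sub_mul, ha]; abel
    rw [e]
    calc _ ≤ ‖a‖ * ‖y - z‖ + ‖y - z‖ * ‖a‖ := (norm_sub_le _ _).trans (add_le_add
          (norm_mul_le _ _) ((norm_mul_le _ _).trans (by gcongr; exact norm_parity_conj_le _)))
      _ ≤ r * (ε / 2) + (ε / 2) * r := by gcongr
      _ = ε * r := by ring
  refine ⟨K, hK, fun g hg => ⟨key _ _ (norm_fockAnnihilation_le b g) (h g hg).1,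
    key _ _ ?_ (h g hg).2⟩⟩
  rw [norm_star_eq]; exact norm_fockAnnihilation_le b g

/-- Since `a(u) a*(u) + a*(u) a(u) = ‖u‖²`, an operator `y` for which `y a(u)` and `y a*(u)` are
small is itself small. -/
theorem norm_mul_norm_le_of_mul_fockAnnihilation {y : FockSpace ι →L[ℂ] FockSpace ι} {u : H}
    {δ : ℝ} (h1 : ‖y * fockAnnihilation b u‖ ≤ δ) (h2 : ‖y * star (fockAnnihilation b u)‖ ≤ δ) :
    ‖y‖ * ‖u‖ ≤ 2 * δ := by
  set a := fockAnnihilation b u with ha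
  have hδ : 0 ≤ δ := (norm_nonneg _).trans h1
  have hn : ‖a‖ ≤ ‖u‖ := norm_fockAnnihilation_le b u
  have e : ((‖u‖ ^ 2 : ℝ) : ℂ) • y = y * a * star a + y * star a * a := by
    rw [mul_assoc, mul_assoc, ← mul_add, fockAnnihilation_star_anticomm,
      inner_self_eq_norm_sq_to_K, mul_smul_comm, mul_one]
    push_cast; rfl
  have h3 : ‖u‖ ^ 2 * ‖y‖ ≤ δ * ‖u‖ + δ * ‖u‖ := by
    have := congrArg norm e
    rw [norm_smul, Complex.norm_real, Real.norm_of_nonneg (sq_nonneg _)] at this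
    rw [this]
    refine (norm_add_le _ _).trans (add_le_add ((norm_mul_le _ _).trans ?_)
      ((norm_mul_le _ _).trans ?_))
    · rw [norm_star_eq]; gcongr
    · gcongr
  rcases (norm_nonneg u).eq_or_lt with h0 | h0
  · rw [← h0, mul_zero]; linarith [(norm_nonneg _).trans h1]
  · nlinarith

theorem fockAnnihilation_add (f g : H) :
    fockAnnihilation b (f + g) = fockAnnihilation b f + fockAnnihilation b g := by
  simpa using fockAnnihilation_add_smul b f g 1

theorem fockAnnihilation_sub (f g : H) :
    fockAnnihilation b (f - g) = fockAnnihilation b f - fockAnnihilation b g := by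
  simpa [sub_eq_add_neg] using fockAnnihilation_add_smul b f g (-1)

theorem fockAnnihilation_zero : fockAnnihilation b (0 : H) = 0 := by
  simpa using fockAnnihilation_sub b (0 : H) 0

theorem fockAnnihilation_smul (c : ℂ) (f : H) :
    fockAnnihilation b (c • f) = (starRingEnd ℂ) c • fockAnnihilation b f := by
  simpa [fockAnnihilation_zero] using fockAnnihilation_add_smul b 0 f c

/-- If `y` intertwines `g` with `g'`, and nearly commutes, up to the parity, with `g`, then the even
part of `y` is small unless `g' ≈ g`, and its odd part is small unless `g' ≈ -g`. -/
theorem norm_even_odd_mul_le {y : FockSpace ι →L[ℂ] FockSpace ι} {g g' : H} {δ : ℝ}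
    (i1 : fockAnnihilation b g * y = y * fockAnnihilation b g')
    (i2 : star (fockAnnihilation b g) * y = y * star (fockAnnihilation b g'))
    (f1 : ‖fockAnnihilation b g * y - parity ι * y * parity ι * fockAnnihilation b g‖ ≤ δ)
    (f2 : ‖star (fockAnnihilation b g) * y -
      parity ι * y * parity ι * star (fockAnnihilation b g)‖ ≤ δ) :
    ‖y + parity ι * y * parity ι‖ * ‖g' - g‖ ≤ 4 * δ ∧
      ‖y - parity ι * y * parity ι‖ * ‖g' + g‖ ≤ 4 * δ := by
  have hP := parity_mul_parity (ι := ι)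
  have key : ∀ a a' : FockSpace ι →L[ℂ] FockSpace ι, parity ι * a = -(a * parity ι) →
      parity ι * a' = -(a' * parity ι) → a * y = y * a' →
      ‖a * y - parity ι * y * parity ι * a‖ ≤ δ →
      ‖(y + parity ι * y * parity ι) * (a' - a)‖ ≤ 2 * δ ∧
        ‖(y - parity ι * y * parity ι) * (a' + a)‖ ≤ 2 * δ := by
    intro a a' ha ha' h hδ
    rw [h] at hδ
    have e : parity ι * (y * a' - parity ι * y * parity ι * a) * parity ι =
        y * a - parity ι * y * parity ι * a' := by
      have c1 : a * parity ι = -(parity ι * a) := by rw [ha, neg_neg]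
      have c2 : a' * parity ι = -(parity ι * a') := by rw [ha', neg_neg]
      simp only [mul_sub, sub_mul, mul_assoc, c1, c2, mul_neg]
      rw [← mul_assoc (parity ι) (parity ι) (y * _), hP, one_mul,
        ← mul_assoc (parity ι) (parity ι) a, hP, one_mul]
      abel
    have hδ' := norm_parity_conj_le (y * a' - parity ι * y * parity ι * a)
    rw [e] at hδ'
    constructor
    · rw [show (y + parity ι * y * parity ι) * (a' - a) =
        (y * a' - parity ι * y * parity ι * a) - (y * a - parity ι * y * parity ι * a') by
          rw [add_mul, mul_sub, mul_sub]; abel]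
      exact (norm_sub_le _ _).trans (by linarith)
    · rw [show (y - parity ι * y * parity ι) * (a' + a) =
        (y * a' - parity ι * y * parity ι * a) + (y * a - parity ι * y * parity ι * a') by
          rw [sub_mul, mul_add, mul_add]; abel]
      exact (norm_add_le _ _).trans (by linarith)
  have k1 := key _ _ (parity_mul_fockAnnihilation b g) (parity_mul_fockAnnihilation b g') i1 f1
  have k2 := key _ _ (parity_mul_star_fockAnnihilation b g) (parity_mul_star_fockAnnihilation b g')
    i2 f2
  rw [← fockAnnihilation_sub, ← fockAnnihilation_add] at k1
  rw [← star_sub, ← star_add, ← fockAnnihilation_sub, ← fockAnnihilation_add] at k2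
  have m1 := norm_mul_norm_le_of_mul_fockAnnihilation b k1.1 k2.1
  have m2 := norm_mul_norm_le_of_mul_fockAnnihilation b k1.2 k2.2
  constructor <;> linarith

end Far

/-! ### Absence of local traps in infinite dimension -/

section Infinite

theorem exists_norm_eq_one_mem_orthogonal {H : Type*} [NormedAddCommGroup H]
    [InnerProductSpace ℂ H] (hinf : ¬ FiniteDimensional ℂ H) (K : Submodule ℂ H)
    [FiniteDimensional ℂ K] : ∃ g ∈ Kᗮ, ‖g‖ = 1 := by
  have hne : Kᗮ ≠ ⊥ := fun h => hinf <| by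
    rw [Submodule.orthogonal_eq_bot_iff] at h
    subst h
    exact Module.Finite.equiv (Submodule.topEquiv : (⊤ : Submodule ℂ H) ≃ₗ[ℂ] H)
  obtain ⟨v, hv, hv0⟩ := Submodule.exists_mem_ne_zero_of_ne_bot hne
  refine ⟨((‖v‖⁻¹ : ℝ) : ℂ) • v, Submodule.smul_mem _ _ hv, ?_⟩
  rw [norm_smul, Complex.norm_real, norm_inv, norm_norm, inv_mul_cancel₀ (norm_ne_zero_iff.2 hv0)]

/-- A surjective operator that is close to the identity off a finite-dimensional subspace is
injective: it is a compact perturbation of the identity, hence of index zero. -/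
theorem injective_of_surjective_of_near_one {H : Type*} [NormedAddCommGroup H]
    [InnerProductSpace ℂ H] [CompleteSpace H] {V : H →L[ℂ] H} (hV : Function.Surjective V)
    (K : Submodule ℂ H) [FiniteDimensional ℂ K]
    (hK : ∀ g ∈ Kᗮ, ‖V g - g‖ ≤ 1 / 2 * ‖g‖) : Function.Injective V := by
  set P : H →L[ℂ] H := K.starProjection with hP
  have hn : ‖(1 - V) * (1 - P)‖ < 1 := by
    refine lt_of_le_of_lt (ContinuousLinearMap.opNorm_le_bound _ (by norm_num : (0:ℝ) ≤ 1 / 2)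
      fun x => ?_) (by norm_num)
    have h1 : (1 - P) x ∈ Kᗮ := by
      rw [sub_apply, one_apply_eq_self]; exact K.sub_starProjection_mem_orthogonal x
    have h2 : ‖(1 - P) x‖ ≤ ‖x‖ := by
      have h3 : (1 - P) x = Kᗮ.starProjection x := by
        rw [Submodule.starProjection_orthogonal]; rfl
      rw [h3]
      exact Kᗮ.norm_starProjection_apply_le x
    rw [mul_apply_eq_comp, ← norm_neg, sub_apply (1 : H →L[ℂ] H) V, one_apply_eq_self, neg_sub]
    calc _ ≤ 1 / 2 * ‖(1 - P) x‖ := hK _ h1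
      _ ≤ _ := by gcongr
  obtain ⟨A, hA⟩ := isUnit_one_sub_of_norm_lt_one hn
  set F : H →L[ℂ] H := (↑A⁻¹ : H →L[ℂ] H) * (1 - V) * P with hF
  have e : 1 - F = (↑A⁻¹ : H →L[ℂ] H) * V := by
    have : V = A - (1 - V) * P := by rw [hA]; noncomm_ring
    conv_rhs => rw [this]
    rw [mul_sub, Units.inv_mul, hF, mul_assoc]
  have hsurj : Function.Surjective (1 - F : H →L[ℂ] H) := by
    rw [e]
    intro y
    obtain ⟨z, hz⟩ := hV (A.val y)
    refine ⟨z, ?_⟩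
    rw [mul_apply_eq_comp, hz, ← mul_apply_eq_comp, Units.inv_mul, one_apply_eq_self]
  set R : Submodule ℂ H := F.toLinearMap.range with hR
  have hRfin : FiniteDimensional ℂ R := by
    have hle : R ≤ K.map ((↑A⁻¹ : H →L[ℂ] H) * (1 - V)).toLinearMap := by
      rintro _ ⟨y, rfl⟩
      exact ⟨P y, K.starProjection_apply_mem y, rfl⟩
    exact Submodule.finiteDimensional_of_le hle
  let G : R →ₗ[ℂ] R := (1 - F).toLinearMap.restrict fun x hx =>
    R.sub_mem hx (LinearMap.mem_range_self _ x)
  have hG : Function.Surjective G := by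
    rintro ⟨r, hr⟩
    obtain ⟨z, hz⟩ := hsurj r
    have hz' : z = r + F z := by rw [← hz, sub_apply, one_apply_eq_self, sub_add_cancel]
    refine ⟨⟨z, hz' ▸ R.add_mem hr (LinearMap.mem_range_self _ z)⟩, Subtype.ext hz⟩
  have hG' := LinearMap.injective_iff_surjective.2 hG
  rw [injective_iff_map_eq_zero]
  intro z hz
  have h1 : (1 - F) z = 0 := by rw [e, mul_apply_eq_comp, hz, map_zero]
  have h2 : z = F z := by rwa [sub_apply, one_apply_eq_self, sub_eq_zero] at h1
  have h3 : z ∈ R := by rw [h2]; exact LinearMap.mem_range_self _ z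
  have h4 : G ⟨z, h3⟩ = 0 := Subtype.ext h1
  exact congrArg Subtype.val ((injective_iff_map_eq_zero G).1 hG' _ h4)

variable {H : Type*} [NormedAddCommGroup H] [InnerProductSpace ℂ H] {ι : Type*} [LinearOrder ι]
  {b : HilbertBasis ι ℂ H} [CompleteSpace H] {J : Type*} [Fintype J] {x : J → carAlgebra b}
  {V : H →L[ℂ] H}

/-- A Kraus operator is, up to `ε`, a polynomial in finitely many modes. Far away from them `V` must
be close to the identity if the even part of `x_j` is not small, and close to `-1` if its odd part
is not small. -/
theorem kraus_even_odd_mul_le (hx : IsOperationalPartition x)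
    (hV : IsQuasiFreeMap b V (partitionMap x))
    (hfin : FiniteDimensional ℂ (1 - star V * V).toLinearMap.range) (j : J) {ε : ℝ} (hε : 0 < ε) :
    ∃ K : Submodule ℂ H, FiniteDimensional ℂ K ∧ ∀ g ∈ Kᗮ,
      ‖(x j : FockSpace ι →L[ℂ] FockSpace ι) + parity ι * x j * parity ι‖ * ‖V g - g‖ ≤ ε * ‖g‖ ∧
      ‖(x j : FockSpace ι →L[ℂ] FockSpace ι) - parity ι * x j * parity ι‖ * ‖V g + g‖ ≤
        ε * ‖g‖ := by
  obtain ⟨K, hK, h⟩ := far_commutation b (x j).2 (show 0 < ε / 4 by positivity)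
  refine ⟨K ⊔ (1 - star V * V).toLinearMap.range, inferInstance, fun g hg => ?_⟩
  have hgK := h g (Submodule.orthogonal_le le_sup_left hg)
  have hgD : (1 - star V * V) g = 0 := by
    have h1 := Submodule.orthogonal_le
      (le_sup_right : _ ≤ K ⊔ (1 - star V * V).toLinearMap.range) hg
    rw [← inner_self_eq_zero (𝕜 := ℂ)]
    have h2 := (isSelfAdjoint_one_sub_star_mul_self V).isSymmetric g ((1 - star V * V) g)
    refine h2.trans ?_
    rw [← inner_conj_symm]
    have h3 := (Submodule.mem_orthogonal _ _).1 h1 ((1 - star V * V) ((1 - star V * V) g))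
      (LinearMap.mem_range_self _ _)
    exact (congrArg (starRingEnd ℂ) h3).trans (map_zero _)
  have i1 := congrArg Subtype.val (annihilation_mul_kraus hx hV g j)
  have i2 := congrArg Subtype.val (star_annihilation_mul_kraus hx hV hgD j)
  have h4 := norm_even_odd_mul_le b i1 i2 hgK.1 hgK.2
  constructor <;> linarith [h4.1, h4.2]

theorem exists_even_part_kraus_ne_zero (hx : IsOperationalPartition x)
    (hV : IsQuasiFreeMap b V (partitionMap x)) :
    ∃ j, (x j : FockSpace ι →L[ℂ] FockSpace ι) + parity ι * x j * parity ι ≠ 0 := by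
  by_contra! h
  have h1 := sum_norm_sq_kraus_vacuum hx hV
  rw [Finset.sum_eq_zero fun j _ => ?_] at h1
  · exact zero_ne_one h1
  · have h2 := congrArg (fun y : FockSpace ι →L[ℂ] FockSpace ι => ⟪vacuum ι, y (vacuum ι)⟫_ℂ) (h j)
    simp only [add_apply, mul_apply_eq_comp, parity_vacuum, inner_add_right, zero_apply,
      inner_zero_right] at h2
    rw [← star_parity, inner_apply_star, parity_vacuum, ← two_mul, mul_eq_zero] at h2
    rw [h2.resolve_left two_ne_zero]
    simp

/-- Over an infinite-dimensional one-particle space no inner quasi-free map is a local trap: if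
`1 - V* V` has finite rank, it vanishes. The Kraus operators must all be even, so `V*` is
isometric, and `V` is a compact perturbation of the identity, so it is unitary. -/
theorem one_sub_star_mul_self_eq_zero (hx : IsOperationalPartition x)
    (hV : IsQuasiFreeMap b V (partitionMap x))
    (hfin : FiniteDimensional ℂ (1 - star V * V).toLinearMap.range)
    (hinf : ¬ FiniteDimensional ℂ H) : 1 - star V * V = 0 := by
  obtain ⟨j, hj⟩ := exists_even_part_kraus_ne_zero hx hV
  set E := (x j : FockSpace ι →L[ℂ] FockSpace ι) + parity ι * x j * parity ι with hE
  have hE0 : 0 < ‖E‖ := norm_pos_iff.2 hj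
  -- far away `V` is close to `1`, so it cannot be close to `-1`, and the odd parts vanish
  have heven : ∀ i, (x i : FockSpace ι →L[ℂ] FockSpace ι) = parity ι * x i * parity ι := by
    intro i
    rw [← sub_eq_zero, ← norm_le_zero_iff]
    refine le_of_forall_pos_le_add fun δ hδ => ?_
    set O := (x i : FockSpace ι →L[ℂ] FockSpace ι) - parity ι * x i * parity ι with hO
    by_contra! hOδ
    rw [zero_add] at hOδ
    set ε := min ‖E‖ δ / 2 with hεd
    have hε : 0 < ε := by positivity
    obtain ⟨K, hK, h1⟩ := kraus_even_odd_mul_le hx hV hfin j hε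
    obtain ⟨L, hL, h2⟩ := kraus_even_odd_mul_le hx hV hfin i hε
    obtain ⟨g, hg, hg1⟩ := exists_norm_eq_one_mem_orthogonal hinf (K ⊔ L)
    have h1 := (h1 g (Submodule.orthogonal_le le_sup_left hg)).1
    have h2 := (h2 g (Submodule.orthogonal_le le_sup_right hg)).2
    rw [hg1, mul_one] at h1 h2
    have e1 : ε ≤ ‖E‖ / 2 := by rw [hεd]; gcongr; exact min_le_left _ _
    have e2 : ε ≤ δ / 2 := by rw [hεd]; gcongr; exact min_le_right _ _
    have n1 : ‖V g - g‖ ≤ 1 / 2 := by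
      by_contra! hc
      nlinarith
    have n2 : ‖V g + g‖ < 1 := by
      by_contra! hc
      nlinarith
    have n3 : ‖(2 : ℂ) • g‖ ≤ ‖V g + g‖ + ‖V g - g‖ := by
      rw [show (2 : ℂ) • g = (V g + g) - (V g - g) by rw [two_smul]; abel]
      exact norm_sub_le _ _
    rw [norm_smul, hg1] at n3
    norm_num at n3
    linarith
  -- even operators do not absorb a single particle
  have hiso : ∀ h, ‖star V h‖ = ‖h‖ := by
    intro h
    have h1 := sum_norm_sq_absorbed hx hV h
    rw [Finset.sum_eq_zero fun i _ => ?_, zero_add] at h1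
    · exact (sq_eq_sq₀ (norm_nonneg _) (norm_nonneg _)).1 h1
    · have h2 : ⟪vacuum ι, (x i : FockSpace ι →L[ℂ] FockSpace ι)
          (star (fockAnnihilation b h) (vacuum ι))⟫_ℂ = -⟪vacuum ι,
            (x i : FockSpace ι →L[ℂ] FockSpace ι)
              (star (fockAnnihilation b h) (vacuum ι))⟫_ℂ := by
        have h3 : parity ι (star (fockAnnihilation b h) (vacuum ι)) =
            -star (fockAnnihilation b h) (vacuum ι) := by
          have := congrArg (fun y : FockSpace ι →L[ℂ] FockSpace ι => y (vacuum ι))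
            (parity_mul_star_fockAnnihilation b h)
          simpa only [mul_apply_eq_comp, neg_apply, parity_vacuum] using this
        conv_lhs => rw [heven i]
        rw [mul_apply_eq_comp, mul_apply_eq_comp, h3, map_neg, map_neg, inner_neg_right,
          ← star_parity, inner_apply_star, parity_vacuum]
      rw [self_eq_neg.1 h2]
      simp
  have hVV : V * star V = 1 := by
    have h1 := (ContinuousLinearMap.norm_map_iff_adjoint_comp_self (star V)).1 hiso
    rwa [← ContinuousLinearMap.star_eq_adjoint, star_star] at h1
  have hsurj : Function.Surjective V := fun y =>
    ⟨star V y, by rw [← mul_apply_eq_comp, hVV, one_apply_eq_self]⟩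
  obtain ⟨K, hK, h⟩ := kraus_even_odd_mul_le hx hV hfin j (show 0 < ‖E‖ / 2 by positivity)
  have hinj := injective_of_surjective_of_near_one hsurj K fun g hg => by
    have := (h g hg).1
    rw [← hE] at this
    nlinarith
  rw [sub_eq_zero]
  ext y
  refine hinj ?_
  rw [one_apply_eq_self, mul_apply_eq_comp, ← mul_apply_eq_comp, hVV, one_apply_eq_self]

end Infinite

/-! ### Entropy of correlation matrices -/

section Entropy

section State

variable {A : Type*} [Ring A] [StarRing A] [Algebra ℂ A] [StarModule ℂ A] {J : Type*} [Fintype J]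
  [DecidableEq J] {ω : A →ₗ[ℂ] ℂ}

omit [DecidableEq J] in
open scoped ComplexOrder in
theorem IsState.posSemidef_correlationMatrix (hω : IsState ω) (x : J → A) :
    (correlationMatrix ω x).PosSemidef := by
  refine Matrix.PosSemidef.of_dotProduct_mulVec_nonneg (hω.isHermitian_correlationMatrix x)
    fun c => ?_
  have e : star c ⬝ᵥ (correlationMatrix ω x).mulVec c =
      ω (star (∑ j, star (c j) • x j) * (∑ i, star (c i) • x i)) := by
    simp only [dotProduct, Matrix.mulVec, correlationMatrix, Matrix.of_apply, star_sum, star_smul,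
      star_star, Finset.sum_mul, Finset.mul_sum, map_sum, smul_mul_smul_comm, map_smul, smul_eq_mul,
      Pi.star_apply]
    refine Finset.sum_congr rfl fun j _ => Finset.sum_congr rfl fun i _ => by ring
  rw [e, Complex.nonneg_iff]
  obtain ⟨h1, h2⟩ := hω.map_star_mul_self (∑ i, star (c i) • x i)
  exact ⟨h1, h2.symm⟩

omit [StarModule ℂ A] [DecidableEq J] in
theorem IsState.trace_correlationMatrix (hω : IsState ω) {x : J → A}
    (hx : IsOperationalPartition x) : (correlationMatrix ω x).trace = 1 := by
  simp only [Matrix.trace, Matrix.diag, correlationMatrix, Matrix.of_apply]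
  rw [← map_sum, hx, hω.map_one]

theorem IsState.eigenvalues_correlationMatrix_mem_Icc (hω : IsState ω) {x : J → A}
    (hx : IsOperationalPartition x) (i : J) :
    (hω.isHermitian_correlationMatrix x).eigenvalues i ∈ Set.Icc (0 : ℝ) 1 := by
  have h0 : ∀ i, 0 ≤ (hω.isHermitian_correlationMatrix x).eigenvalues i :=
    (hω.posSemidef_correlationMatrix x).eigenvalues_nonneg
  refine ⟨h0 i, ?_⟩
  have h1 := (hω.isHermitian_correlationMatrix x).trace_eq_sum_eigenvalues
  rw [hω.trace_correlationMatrix hx] at h1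
  have h2 : ∑ i, (hω.isHermitian_correlationMatrix x).eigenvalues i = 1 := by
    refine Complex.ofReal_injective ?_
    rw [Complex.ofReal_sum, Complex.ofReal_one]
    exact h1.symm
  rw [← h2]
  exact Finset.single_le_sum (fun i _ => h0 i) (Finset.mem_univ i)

theorem IsState.partitionEntropy_nonneg (hω : IsState ω) {x : J → A}
    (hx : IsOperationalPartition x) : 0 ≤ partitionEntropy hω x :=
  Finset.sum_nonneg fun i _ => by
    have h := hω.eigenvalues_correlationMatrix_mem_Icc hx i
    exact Real.negMulLog_nonneg h.1 h.2

end State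

variable {J : Type*} [Fintype J] [DecidableEq J]

/-- Orthonormal eigenvectors bound the entropy from below by the contribution of their
eigenvalues. -/
theorem sum_negMulLog_le_of_orthonormal {ρ : Matrix J J ℂ} (hρ : ρ.IsHermitian)
    (h01 : ∀ i, hρ.eigenvalues i ∈ Set.Icc (0 : ℝ) 1) {R : Type*} [Fintype R]
    {e : R → EuclideanSpace ℂ J} (he : Orthonormal ℂ e) (p : R → ℝ)
    (hp : ∀ r, Matrix.toEuclideanLin ρ (e r) = (p r : ℂ) • e r) :
    ∑ r, Real.negMulLog (p r) ≤ ∑ i, Real.negMulLog (hρ.eigenvalues i) := by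
  have hsym : (Matrix.toEuclideanLin ρ).IsSymmetric := Matrix.isSymmetric_toEuclideanLin_iff.2 hρ
  set u := hρ.eigenvectorBasis
  have hu : ∀ i, Matrix.toEuclideanLin ρ (u i) = (hρ.eigenvalues i : ℂ) • u i := fun i => by
    ext j
    have := congrFun (hρ.mulVec_eigenvectorBasis i) j
    simpa using this
  have key : ∀ r i, ‖⟪e r, u i⟫_ℂ‖ ^ 2 * Real.negMulLog (hρ.eigenvalues i) =
      ‖⟪e r, u i⟫_ℂ‖ ^ 2 * Real.negMulLog (p r) := fun r i => by
    have h := hsym (e r) (u i)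
    rw [hp, hu, inner_smul_left, inner_smul_right, Complex.conj_ofReal, mul_eq_mul_right_iff] at h
    rcases h with h | h
    · rw [Complex.ofReal_injective h]
    · rw [h]; simp
  calc ∑ r, Real.negMulLog (p r)
      = ∑ r, ∑ i, ‖⟪e r, u i⟫_ℂ‖ ^ 2 * Real.negMulLog (p r) := by
        refine Finset.sum_congr rfl fun r _ => ?_
        rw [← Finset.sum_mul, u.sum_sq_norm_inner_left, he.1 r]; simp
    _ = ∑ i, (∑ r, ‖⟪e r, u i⟫_ℂ‖ ^ 2) * Real.negMulLog (hρ.eigenvalues i) := by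
        rw [Finset.sum_comm]
        simp_rw [Finset.sum_mul, key]
    _ ≤ ∑ i, 1 * Real.negMulLog (hρ.eigenvalues i) := by
        refine Finset.sum_le_sum fun i _ => mul_le_mul_of_nonneg_right ?_
          (Real.negMulLog_nonneg (h01 i).1 (h01 i).2)
        have h := he.sum_inner_products_le (u i) (s := Finset.univ)
        rwa [u.orthonormal.1 i, one_pow] at h
    _ = _ := by simp

/-- A variant of `sum_negMulLog_le_of_orthonormal` for orthogonal eigenvectors, which may vanish
where the claimed eigenvalue is zero. -/
theorem sum_negMulLog_le_of_orthogonal {ρ : Matrix J J ℂ} (hρ : ρ.IsHermitian)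
    (h01 : ∀ i, hρ.eigenvalues i ∈ Set.Icc (0 : ℝ) 1) {R : Type*} [Fintype R] [DecidableEq R]
    {e : R → J → ℂ} {s : R → ℝ}
    (he : ∀ r r', ∑ j, (starRingEnd ℂ) (e r j) * e r' j = if r = r' then (s r : ℂ) else 0)
    (p : R → ℝ) (hp : ∀ r, ρ.mulVec (e r) = (p r : ℂ) • e r) (hps : ∀ r, s r = 0 → p r = 0) :
    ∑ r, Real.negMulLog (p r) ≤ ∑ i, Real.negMulLog (hρ.eigenvalues i) := by
  have hinner : ∀ r r', ⟪(WithLp.toLp 2 (e r) : EuclideanSpace ℂ J), WithLp.toLp 2 (e r')⟫_ℂ =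
      if r = r' then (s r : ℂ) else 0 := fun r r' => by
    rw [← he r r', PiLp.inner_apply]
    exact Finset.sum_congr rfl fun j _ => mul_comm _ _
  have hs : ∀ r, ‖(WithLp.toLp 2 (e r) : EuclideanSpace ℂ J)‖ ^ 2 = s r := fun r => by
    have h := hinner r r
    rw [if_pos rfl, inner_self_eq_norm_sq_to_K] at h
    refine Complex.ofReal_injective (Eq.trans ?_ h)
    rw [Complex.ofReal_pow]
    rfl
  have hs0 : ∀ r, 0 ≤ s r := fun r => hs r ▸ sq_nonneg _
  let v : {r // s r ≠ 0} → EuclideanSpace ℂ J := fun r =>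
    (((√(s r))⁻¹ : ℝ) : ℂ) • WithLp.toLp 2 (e r)
  have hv : Orthonormal ℂ v := by
    rw [orthonormal_iff_ite]
    intro r r'
    rw [inner_smul_left, inner_smul_right, hinner, Complex.conj_ofReal]
    by_cases h : r = r'
    · subst h
      rw [if_pos rfl, if_pos rfl]
      norm_cast
      have h1 : √(s r) * √(s r) = s r := Real.mul_self_sqrt (hs0 _)
      have h2 : √(s r) ≠ 0 := (Real.sqrt_ne_zero (hs0 _)).2 r.2
      field_simp
      nlinarith
    · rw [if_neg h, if_neg fun h' => h (Subtype.ext h'), mul_zero, mul_zero]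
  have h := sum_negMulLog_le_of_orthonormal hρ h01 hv (fun r => p r) fun r => by
    rw [map_smul, smul_comm]
    congr 1
    ext j
    have := congrFun (hp r) j
    simpa using this
  refine le_trans (le_of_eq ?_) h
  rw [← Finset.sum_subtype (Finset.univ.filter fun r => s r ≠ 0) (by simp)
    (fun r => Real.negMulLog (p r)), Finset.sum_filter]
  refine Finset.sum_congr rfl fun r _ => ?_
  split_ifs with h0
  · rfl
  · rw [hps r (not_not.1 h0), Real.negMulLog_zero]

/-- Additivity of the entropy: the distribution of independent events of probabilities `p_k`. -/
theorem sum_negMulLog_prod {K : Type*} [DecidableEq K] (p : K → ℝ) (s : Finset K) :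
    ∑ R ∈ s.powerset, Real.negMulLog ((∏ k ∈ R, p k) * ∏ k ∈ s \ R, (1 - p k)) =
      ∑ k ∈ s, (Real.negMulLog (p k) + Real.negMulLog (1 - p k)) := by
  induction s using Finset.induction_on with
  | empty => simp
  | insert a s ha ih =>
    have htot : ∑ R ∈ s.powerset, (∏ k ∈ R, p k) * ∏ k ∈ s \ R, (1 - p k) = 1 := by
      rw [← Finset.prod_add]; simp
    rw [Finset.sum_powerset_insert ha, Finset.sum_insert ha, ← ih]
    have h1 : ∀ R ∈ s.powerset,
        Real.negMulLog ((∏ k ∈ R, p k) * ∏ k ∈ insert a s \ R, (1 - p k)) =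
        (1 - p a) * Real.negMulLog ((∏ k ∈ R, p k) * ∏ k ∈ s \ R, (1 - p k)) +
          ((∏ k ∈ R, p k) * ∏ k ∈ s \ R, (1 - p k)) * Real.negMulLog (1 - p a) := fun R hR => by
      have haR : a ∉ R := fun h => ha (Finset.mem_powerset.1 hR h)
      rw [Finset.insert_sdiff_of_notMem _ haR, Finset.prod_insert (by simp [ha]),
        mul_left_comm, Real.negMulLog_mul]
      ring
    have h2 : ∀ R ∈ s.powerset,
        Real.negMulLog ((∏ k ∈ insert a R, p k) * ∏ k ∈ insert a s \ insert a R, (1 - p k)) =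
        p a * Real.negMulLog ((∏ k ∈ R, p k) * ∏ k ∈ s \ R, (1 - p k)) +
          ((∏ k ∈ R, p k) * ∏ k ∈ s \ R, (1 - p k)) * Real.negMulLog (p a) := fun R hR => by
      have haR : a ∉ R := fun h => ha (Finset.mem_powerset.1 hR h)
      rw [Finset.prod_insert haR, Finset.insert_sdiff_insert, Finset.sdiff_insert_of_notMem ha,
        mul_assoc, Real.negMulLog_mul]
      ring
    rw [Finset.sum_congr rfl h1, Finset.sum_congr rfl h2, Finset.sum_add_distrib,
      Finset.sum_add_distrib, ← Finset.mul_sum, ← Finset.mul_sum, ← Finset.sum_mul,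
      ← Finset.sum_mul, htot]
    ring

/-- Concavity of the binary entropy, which vanishes at `0`. -/
theorem mul_binEntropy_le {κ s : ℝ} (hκ₀ : 0 ≤ κ) (hκ₁ : κ ≤ 1) (hs₀ : 0 ≤ s) (hs₁ : s ≤ 1) :
    s * (Real.negMulLog κ + Real.negMulLog (1 - κ)) ≤
      Real.negMulLog (κ * s) + Real.negMulLog (1 - κ * s) := by
  rw [← Real.binEntropy_eq_negMulLog_add_negMulLog_one_sub,
    ← Real.binEntropy_eq_negMulLog_add_negMulLog_one_sub]
  have h := Real.strictConcave_binEntropy.concaveOn.2 (x := κ) ⟨hκ₀, hκ₁⟩ (y := 0)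
    ⟨le_rfl, zero_le_one⟩ hs₀ (sub_nonneg.2 hs₁) (by ring)
  simpa [mul_comm] using h

end Entropy

/-! ### Occupation number vectors of an orthonormal family -/

section Occupation

variable {H : Type*} [NormedAddCommGroup H] [InnerProductSpace ℂ H] {ι : Type*} [LinearOrder ι]
  (b : HilbertBasis ι ℂ H) {K : Type*} [LinearOrder K]

/-- The product `a*(w_{k₁}) ⋯ a*(w_{kₙ})` of creation operators over the elements
`k₁ < ⋯ < kₙ` of the finite set `S`. -/
noncomputable def creationProd (w : K → H) (S : Finset K) : carAlgebra b :=
  (S.sort.map fun k => star (annihilation b (w k))).prod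

/-- The vector `a*(w_{k₁}) ⋯ a*(w_{kₙ}) Ω`, where `k₁ < ⋯ < kₙ` are the elements of `S`. -/
noncomputable def occupation (w : K → H) (S : Finset K) : FockSpace ι :=
  (creationProd b w S : FockSpace ι →L[ℂ] FockSpace ι) (vacuum ι)

variable {w : K → H}

theorem creationProd_empty : creationProd b w ∅ = 1 := by simp [creationProd]

theorem occupation_empty : occupation b w ∅ = vacuum ι := by
  rw [occupation, creationProd_empty]; rfl

theorem creationProd_insert {a : K} {S : Finset K} (ha : ∀ k ∈ S, a < k) :
    creationProd b w (insert a S) = star (annihilation b (w a)) * creationProd b w S := by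
  rw [creationProd, Finset.sort_insert _ (fun k hk => (ha k hk).le)
    (fun h => lt_irrefl _ (ha a h)), List.map_cons, List.prod_cons, creationProd]

theorem occupation_insert {a : K} {S : Finset K} (ha : ∀ k ∈ S, a < k) :
    occupation b w (insert a S) = star (fockAnnihilation b (w a)) (occupation b w S) := by
  rw [occupation, creationProd_insert b ha]; rfl

theorem star_fockAnnihilation_anticomm_apply (f g : H) (ψ : FockSpace ι) :
    star (fockAnnihilation b f) (star (fockAnnihilation b g) ψ) =
      -star (fockAnnihilation b g) (star (fockAnnihilation b f) ψ) := by
  have h := congrArg star (fockAnnihilation_anticomm b f g)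
  rw [star_add, star_mul, star_mul, star_zero] at h
  have h1 := congrArg (fun B : FockSpace ι →L[ℂ] FockSpace ι => B ψ) h
  exact eq_neg_of_add_eq_zero_right h1

theorem star_fockAnnihilation_occupation (k : K) (S : Finset K) :
    ∃ c : ℂ, star (fockAnnihilation b (w k)) (occupation b w S) =
      c • occupation b w (insert k S) := by
  induction S using Finset.induction_on_min with
  | empty => exact ⟨1, by rw [one_smul, occupation_insert b (by simp)]⟩
  | insert a S ha ih =>
    rcases lt_trichotomy k a with hk | rfl | hk
    · refine ⟨1, ?_⟩
      rw [one_smul, occupation_insert b (a := k)]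
      intro l hl
      rcases Finset.mem_insert.1 hl with rfl | hl
      · exact hk
      · exact hk.trans (ha l hl)
    · refine ⟨0, ?_⟩
      rw [occupation_insert b ha, zero_smul]
      have h := star_fockAnnihilation_anticomm_apply b (w k) (w k) (occupation b w S)
      have h2 : (2 : ℂ) • star (fockAnnihilation b (w k))
          (star (fockAnnihilation b (w k)) (occupation b w S)) = 0 := by
        rw [two_smul]; exact eq_neg_iff_add_eq_zero.1 h
      exact (smul_eq_zero.1 h2).resolve_left two_ne_zero
    · obtain ⟨c, hc⟩ := ih
      refine ⟨-c, ?_⟩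
      rw [occupation_insert b ha, star_fockAnnihilation_anticomm_apply, hc, map_smul, neg_smul,
        Finset.insert_comm, occupation_insert b (a := a)]
      intro l hl
      rcases Finset.mem_insert.1 hl with rfl | hl
      · exact hk
      · exact ha l hl

theorem fockAnnihilation_occupation (hw : Orthonormal ℂ w) (k : K) (S : Finset K) :
    fockAnnihilation b (w k) (occupation b w S) =
      if k ∈ S then fermiSign k (S.erase k) • occupation b w (S.erase k) else 0 := by
  induction S using Finset.induction_on_min with
  | empty => simp [occupation_empty, fockAnnihilation_vacuum]
  | insert a S ha ih =>
    have haS : a ∉ S := fun h => lt_irrefl _ (ha a h)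
    rw [occupation_insert b ha, fockAnnihilation_star_apply, ih]
    by_cases hka : k = a
    · subst hka
      have hsgn : fermiSign k S = 1 :=
        Finset.prod_eq_one fun j hj => if_neg (ha j hj).not_gt
      rw [if_neg haS, map_zero, sub_zero, if_pos (Finset.mem_insert_self _ _),
        Finset.erase_insert haS, hsgn, inner_self_eq_norm_sq_to_K, hw.1 k]
      simp
    · rw [hw.2 hka, zero_smul, zero_sub]
      by_cases hkS : k ∈ S
      · have hak : a < k := ha k hkS
        rw [if_pos hkS, if_pos (Finset.mem_insert_of_mem hkS), map_smul,
          ← occupation_insert b fun l hl => ha l (Finset.mem_of_mem_erase hl),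
          Finset.erase_insert_of_ne (Ne.symm hka),
          fermiSign_insert _ _ _ fun h => haS (Finset.mem_of_mem_erase h), if_pos hak, ← neg_smul,
          neg_one_mul]
      · rw [if_neg hkS, if_neg (by simp [hka, hkS]), map_zero, neg_zero]

/-- The adjoint of the creation product over `S` removes the particles in `S`, up to a sign, and
kills the vectors in which one of them is missing. -/
theorem exists_star_creationProd_occupation (hw : Orthonormal ℂ w) :
    ∃ ε : Finset K → Finset K → ℂ, (∀ S R, (starRingEnd ℂ) (ε S R) * ε S R = 1) ∧
      ∀ S R, star (creationProd b w S : FockSpace ι →L[ℂ] FockSpace ι) (occupation b w R) =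
        if S ⊆ R then ε S R • occupation b w (R \ S) else 0 := by
  suffices h : ∀ S R, ∃ ε : ℂ, (starRingEnd ℂ) ε * ε = 1 ∧
      star (creationProd b w S : FockSpace ι →L[ℂ] FockSpace ι) (occupation b w R) =
        if S ⊆ R then ε • occupation b w (R \ S) else 0 by
    choose ε h1 h2 using h
    exact ⟨ε, h1, h2⟩
  intro S
  induction S using Finset.induction_on_min with
  | empty =>
    intro R
    refine ⟨1, by simp, ?_⟩
    rw [creationProd_empty]
    simp
  | insert a S ha ih =>
    intro R
    have haS : a ∉ S := fun h => lt_irrefl _ (ha a h)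
    have e : star (creationProd b w (insert a S) : FockSpace ι →L[ℂ] FockSpace ι)
        (occupation b w R) = star (creationProd b w S : FockSpace ι →L[ℂ] FockSpace ι)
          (fockAnnihilation b (w a) (occupation b w R)) := by
      rw [creationProd_insert b ha]
      change (star (star (fockAnnihilation b (w a)) *
        (creationProd b w S : FockSpace ι →L[ℂ] FockSpace ι))) _ = _
      rw [star_mul, star_star]
      rfl
    rw [e, fockAnnihilation_occupation b hw]
    obtain ⟨ε, h1, h2⟩ := ih (R.erase a)
    refine ⟨fermiSign a (R.erase a) * ε, ?_, ?_⟩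
    · rw [map_mul, conj_fermiSign, mul_mul_mul_comm, fermiSign_mul_self, one_mul, h1]
    · by_cases haR : a ∈ R
      · rw [if_pos haR, map_smul, h2]
        have e1 : S ⊆ R.erase a ↔ insert a S ⊆ R := by
          rw [Finset.insert_subset_iff, Finset.subset_erase]; tauto
        have e2 : R.erase a \ S = R \ insert a S := by
          ext l; simp; tauto
        simp only [e1, e2]
        split_ifs
        · rw [smul_smul]
        · rw [smul_zero]
      · rw [if_neg haR, if_neg fun h => haR (h (Finset.mem_insert_self _ _)), map_zero]

theorem inner_vacuum_occupation (S : Finset K) :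
    ⟪vacuum ι, occupation b w S⟫_ℂ = if S = ∅ then 1 else 0 := by
  induction S using Finset.induction_on_min with
  | empty => rw [occupation_empty, inner_vacuum_vacuum, if_pos rfl]
  | insert a S ha _ =>
    rw [occupation_insert b ha, inner_apply_star, fockAnnihilation_vacuum, inner_zero_left,
      if_neg (Finset.insert_ne_empty _ _)]

theorem inner_occupation (S : Finset K) (ψ : FockSpace ι) :
    ⟪occupation b w S, ψ⟫_ℂ =
      ⟪vacuum ι, star (creationProd b w S : FockSpace ι →L[ℂ] FockSpace ι) ψ⟫_ℂ := by
  rw [inner_apply_star]; rfl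

theorem orthonormal_occupation (hw : Orthonormal ℂ w) : Orthonormal ℂ (occupation b w) := by
  obtain ⟨ε, h1, h2⟩ := exists_star_creationProd_occupation b hw
  have h3 : ∀ S R, ⟪occupation b w S, occupation b w R⟫_ℂ = if S = R then ε S R else 0 := by
    intro S R
    rw [inner_occupation, h2]
    by_cases hSR : S = R
    · subst hSR
      rw [if_pos subset_rfl, if_pos rfl, inner_smul_right, inner_vacuum_occupation,
        if_pos (Finset.sdiff_self S), mul_one]
    · rw [if_neg hSR]
      split_ifs with h
      · rw [inner_smul_right, inner_vacuum_occupation, if_neg, mul_zero]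
        rw [Finset.sdiff_eq_empty_iff_subset]
        exact fun h' => hSR (h.antisymm h')
      · rw [inner_zero_right]
  refine ⟨fun S => ?_, fun S R hSR => (h3 S R).trans (if_neg hSR)⟩
  -- the sign `ε S S` is the squared norm of a vector, and it has modulus one
  have h4 := h3 S S
  rw [if_pos rfl, inner_self_eq_norm_sq_to_K] at h4
  have h5 := h1 S S
  rw [← h4] at h5
  have h6 : ‖occupation b w S‖ ^ 2 * ‖occupation b w S‖ ^ 2 = 1 := by
    refine Complex.ofReal_injective ?_
    simpa using h5
  have h7 : ‖occupation b w S‖ ^ 4 = 1 := by rw [← h6]; ring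
  exact (pow_eq_one_iff_of_nonneg (norm_nonneg _) (by norm_num)).1 h7

end Occupation

section Complete

variable {H : Type*} [NormedAddCommGroup H] [InnerProductSpace ℂ H] {ι : Type*} [LinearOrder ι]
  (b : HilbertBasis ι ℂ H) {K : Type*} [LinearOrder K] [Fintype K] (w : OrthonormalBasis K ℂ H)

theorem star_fockAnnihilation_mem_span_occupation (g : H) {φ : FockSpace ι}
    (hφ : φ ∈ Submodule.span ℂ (Set.range (occupation b w))) :
    star (fockAnnihilation b g) φ ∈ Submodule.span ℂ (Set.range (occupation b w)) := by
  have hg : g ∈ Submodule.span ℂ (Set.range w.toBasis) := by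
    rw [w.toBasis.span_eq]; exact Submodule.mem_top
  induction hg using Submodule.span_induction with
  | mem g hg =>
    obtain ⟨k, rfl⟩ := hg
    rw [w.coe_toBasis]
    induction hφ using Submodule.span_induction with
    | mem φ hφ =>
      obtain ⟨S, rfl⟩ := hφ
      obtain ⟨c, hc⟩ := star_fockAnnihilation_occupation b (w := w) k S
      rw [hc]
      exact Submodule.smul_mem _ _ (Submodule.subset_span ⟨_, rfl⟩)
    | zero => rw [map_zero]; exact Submodule.zero_mem _
    | add φ ψ _ _ h1 h2 => rw [map_add]; exact Submodule.add_mem _ h1 h2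
    | smul c φ _ h => rw [map_smul]; exact Submodule.smul_mem _ _ h
  | zero =>
    rw [fockAnnihilation_zero, star_zero, zero_apply]
    exact Submodule.zero_mem _
  | add f g _ _ h1 h2 =>
    rw [fockAnnihilation_add, star_add, add_apply]
    exact Submodule.add_mem _ h1 h2
  | smul c g _ h =>
    rw [fockAnnihilation_smul, star_smul, smul_apply]
    exact Submodule.smul_mem _ _ h

theorem span_occupation_orthogonal :
    (Submodule.span ℂ (Set.range (occupation b w)))ᗮ = ⊥ := by
  rw [Submodule.eq_bot_iff]
  intro ψ hψ
  have hS : ∀ S : Finset ι, (lp.single 2 S (1 : ℂ) : FockSpace ι) ∈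
      Submodule.span ℂ (Set.range (occupation b w)) := by
    intro S
    induction S using Finset.induction_on with
    | empty =>
      refine Submodule.subset_span ⟨∅, ?_⟩
      rw [occupation_empty]; rfl
    | insert i S hi ih =>
      have h := star_fockAnnihilation_mem_span_occupation b w (b i) ih
      rw [fockAnnihilation_basis, star_star] at h
      have e : (lp.single 2 (insert i S) (1 : ℂ) : FockSpace ι) =
          fermiSign i S • createMode i (lp.single 2 S (1 : ℂ)) := by
        ext R
        rw [lp.coeFn_smul, Pi.smul_apply, createMode_apply]
        by_cases hR : R = insert i S
        · subst hR
          rw [if_pos (Finset.mem_insert_self _ _), Finset.erase_insert hi, lp.single_apply_self,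
            lp.single_apply_self, fermiSign_insert _ _ _ hi, if_neg (lt_irrefl _), one_mul, mul_one,
            smul_eq_mul, fermiSign_mul_self]
        · rw [lp.single_apply_ne _ _ _ hR]
          split_ifs with h
          · rw [lp.single_apply_ne, mul_zero, smul_zero]
            exact fun h' => hR (by rw [← h', Finset.insert_erase h])
          · rw [smul_zero]
      rw [e]
      exact Submodule.smul_mem _ _ h
  ext S
  have h := (Submodule.mem_orthogonal _ _).1 hψ _ (hS S)
  rw [lp.inner_single_left] at h
  simpa using h

/-- For an orthonormal basis of a finite-dimensional one-particle space, the occupation number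
vectors form an orthonormal basis of Fock space. -/
noncomputable def occupationBasis : OrthonormalBasis (Finset K) ℂ (FockSpace ι) :=
  OrthonormalBasis.mkOfOrthogonalEqBot (orthonormal_occupation b w.orthonormal)
    (span_occupation_orthogonal b w)

theorem occupationBasis_apply (S : Finset K) : occupationBasis b w S = occupation b w S := by
  rw [occupationBasis, OrthonormalBasis.coe_of_orthogonal_eq_bot_mk]

theorem ext_occupation {S T : FockSpace ι →L[ℂ] FockSpace ι}
    (h : ∀ R, S (occupation b w R) = T (occupation b w R)) : S = T := by
  refine ContinuousLinearMap.coe_injective ((occupationBasis b w).toBasis.ext fun R => ?_)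
  rw [OrthonormalBasis.coe_toBasis, occupationBasis_apply]
  exact h R

theorem inner_occupation_occupation (S R : Finset K) :
    ⟪occupation b w S, occupation b w R⟫_ℂ = if S = R then 1 else 0 :=
  orthonormal_iff_ite.1 (orthonormal_occupation b w.orthonormal) S R

/-- The creation product over `S` times its adjoint projects onto the occupation number vectors
in which all modes of `S` are occupied. -/
theorem creationProd_mul_star_occupation (S R : Finset K) :
    (creationProd b w S : FockSpace ι →L[ℂ] FockSpace ι)
      (star (creationProd b w S : FockSpace ι →L[ℂ] FockSpace ι) (occupation b w R)) =
      if S ⊆ R then occupation b w R else 0 := by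
  obtain ⟨ε, h1, h2⟩ := exists_star_creationProd_occupation b w.orthonormal
  by_cases hSR : S ⊆ R
  · rw [if_pos hSR]
    refine (occupationBasis b w).repr.injective (PiLp.ext fun Q => ?_)
    rw [OrthonormalBasis.repr_apply_apply, OrthonormalBasis.repr_apply_apply,
      occupationBasis_apply, ← inner_star_apply, h2, h2,
      if_pos hSR, inner_occupation_occupation]
    by_cases hSQ : S ⊆ Q
    · rw [if_pos hSQ, inner_smul_left, inner_smul_right, inner_occupation_occupation]
      by_cases hQR : Q = R
      · subst hQR
        rw [if_pos rfl, if_pos rfl, mul_one, h1]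
      · rw [if_neg hQR, if_neg, mul_zero, mul_zero]
        exact fun h => hQR (by
          rw [← Finset.sdiff_union_of_subset hSQ, h, Finset.sdiff_union_of_subset hSR])
    · rw [if_neg hSQ, inner_zero_left, if_neg]
      rintro rfl
      exact hSQ hSR
  · rw [h2, if_neg hSR, if_neg hSR, map_zero]

end Complete

/-! ### The density of a quasi-free state in finite dimension -/

section Density

theorem star_list_prod {A : Type*} [Monoid A] [StarMul A] (l : List A) :
    star l.prod = (l.map star).reverse.prod := by
  induction l with
  | nil => simp
  | cons a l ih => simp [ih]

theorem reverse_ofFn {α : Type*} {n : ℕ} (f : Fin n → α) :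
    (List.ofFn f).reverse = List.ofFn fun i => f i.rev := by
  refine List.ext_getElem (by simp) fun i h1 h2 => ?_
  simp only [List.length_ofFn] at h2
  simp only [List.getElem_reverse, List.getElem_ofFn, List.length_ofFn]
  congr 1
  ext
  simp [Fin.val_rev]
  omega

theorem wickMonomial_eq_mul_star {H : Type*} [NormedAddCommGroup H] [InnerProductSpace ℂ H]
    {ι : Type*} [LinearOrder ι] (b : HilbertBasis ι ℂ H) {n m : ℕ} (f : Fin n → H)
    (g : Fin m → H) :
    wickMonomial b f g = (List.ofFn fun j => star (annihilation b (f j))).prod *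
      star (List.ofFn fun j => star (annihilation b (g j))).prod := by
  rw [wickMonomial, star_list_prod, List.map_ofFn, reverse_ofFn]
  simp

variable {H : Type*} [NormedAddCommGroup H] [InnerProductSpace ℂ H] {ι : Type*} [LinearOrder ι]
  {b : HilbertBasis ι ℂ H} {K : Type*} {κ : ℝ} {ω : carAlgebra b →ₗ[ℂ] ℂ} {w : K → H}

theorem map_wickMonomial_of_orthonormal [DecidableEq K]
    (hω : IsQuasiFreeState b ((κ : ℂ) • 1) ω) (hw : Orthonormal ℂ w)
    {n : ℕ} (f g : Fin n → K) :
    ω (wickMonomial b (fun i => w (f i)) (fun i => w (g i))) =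
      (Matrix.of fun i j => if g i = f j then (κ : ℂ) else 0).det := by
  rw [hω.map_wickMonomial]
  congr 1
  ext i j
  rw [Matrix.of_apply, Matrix.of_apply, smul_apply, one_apply_eq_self, inner_smul_right,
    orthonormal_iff_ite.1 hw, mul_ite, mul_one, mul_zero]

theorem map_prod_mul_star_prod_self (hω : IsQuasiFreeState b ((κ : ℂ) • 1) ω)
    (hw : Orthonormal ℂ w) {l : List K} (hl : l.Nodup) :
    ω ((l.map fun k => star (annihilation b (w k))).prod *
      star (l.map fun k => star (annihilation b (w k))).prod) = (κ : ℂ) ^ l.length := by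
  classical
  have h := map_wickMonomial_of_orthonormal hω hw l.get l.get
  rw [wickMonomial_eq_mul_star] at h
  have e : (List.ofFn fun j => star (annihilation b (w (l.get j)))) =
      l.map fun k => star (annihilation b (w k)) := by
    conv_rhs => rw [← List.ofFn_get l, List.map_ofFn]
    rfl
  rw [e] at h
  rw [h]
  have e2 : (Matrix.of fun i j => if l.get i = l.get j then (κ : ℂ) else 0) =
      Matrix.diagonal fun _ => (κ : ℂ) := by
    ext i j
    rw [Matrix.of_apply, Matrix.diagonal_apply]
    simp only [hl.get_inj_iff]
  rw [e2, Matrix.det_diagonal]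
  simp

/-- The determinant defining the state vanishes when two of its columns agree, or one is zero. -/
theorem map_prod_mul_star_prod_eq_zero (hω : IsQuasiFreeState b ((κ : ℂ) • 1) ω)
    (hw : Orthonormal ℂ w) {l l' : List K}
    (h : l.length ≠ l'.length ∨ ¬ l.Nodup ∨ ∃ k ∈ l, k ∉ l') :
    ω ((l.map fun k => star (annihilation b (w k))).prod *
      star (l'.map fun k => star (annihilation b (w k))).prod) = 0 := by
  classical
  obtain ⟨n, f, rfl⟩ : ∃ n, ∃ f : Fin n → K, l = List.ofFn f := ⟨_, l.get, (List.ofFn_get l).symm⟩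
  obtain ⟨m, g, rfl⟩ : ∃ m, ∃ g : Fin m → K, l' = List.ofFn g :=
    ⟨_, l'.get, (List.ofFn_get l').symm⟩
  have e := wickMonomial_eq_mul_star b (fun i => w (f i)) (fun i => w (g i))
  rw [List.map_ofFn, List.map_ofFn]
  refine (congrArg ω e.symm).trans ?_
  by_cases hnm : n = m
  swap
  · exact hω.map_wickMonomial_of_ne _ _ _ _ hnm
  subst hnm
  rw [map_wickMonomial_of_orthonormal hω hw]
  rcases h with h | h | ⟨k, hk, hk'⟩
  · simp at h
  · rw [List.nodup_ofFn] at h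
    obtain ⟨i, j, hij, hne⟩ : ∃ i j, f i = f j ∧ i ≠ j := by
      simpa [Function.Injective] using h
    exact Matrix.det_zero_of_column_eq hne fun k => by simp [hij]
  · rw [List.mem_ofFn] at hk hk'
    obtain ⟨j, rfl⟩ := hk
    exact Matrix.det_eq_zero_of_column_eq_zero j fun i => by
      rw [Matrix.of_apply, if_neg fun h => hk' ⟨i, h⟩]

variable [LinearOrder K]

theorem map_creationProd_mul_star (hω : IsQuasiFreeState b ((κ : ℂ) • 1) ω)
    (hw : Orthonormal ℂ w) (T T' S : Finset K) :
    ω (creationProd b w T * creationProd b w S * star (creationProd b w T' * creationProd b w S)) =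
      if T = T' ∧ Disjoint S T then (κ : ℂ) ^ (T.card + S.card) else 0 := by
  have e : ∀ T, creationProd b w T * creationProd b w S =
      ((T.sort ++ S.sort).map fun k => star (annihilation b (w k))).prod := fun T => by
    rw [List.map_append, List.prod_append]; rfl
  have hnd : ∀ T, (T.sort ++ S.sort).Nodup ↔ Disjoint S T := fun T => by
    rw [List.nodup_append, Finset.disjoint_right]
    simp only [Finset.sort_nodup, Finset.mem_sort, true_and]
    exact ⟨fun h k hT hS => h k hT k hS rfl, fun h k hT l hS hkl => h hT (hkl ▸ hS)⟩
  rw [e, e]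
  by_cases hT : T = T'
  · subst hT
    by_cases hS : Disjoint S T
    · rw [if_pos ⟨rfl, hS⟩, map_prod_mul_star_prod_self hω hw ((hnd T).2 hS)]
      simp
    · rw [if_neg fun h => hS h.2]
      exact map_prod_mul_star_prod_eq_zero hω hw (Or.inr (Or.inl ((hnd T).not.2 hS)))
  · rw [if_neg fun h => hT h.1]
    refine map_prod_mul_star_prod_eq_zero hω hw ?_
    by_cases hc : T.card = T'.card
    · obtain ⟨k, hk, hk'⟩ : ∃ k ∈ T, k ∉ T' :=
        Finset.not_subset.1 fun h => hT (Finset.eq_of_subset_of_card_le h hc.ge)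
      by_cases hkS : k ∈ S
      · exact Or.inr (Or.inl ((hnd T).not.2 fun h => Finset.disjoint_left.1 h hkS hk))
      · exact Or.inr (Or.inr ⟨k, by simp [hk], by simp [hk', hkS]⟩)
    · exact Or.inl (by simpa using hc)

end Density

section Vacuum

variable {H : Type*} [NormedAddCommGroup H] [InnerProductSpace ℂ H] {ι : Type*} [LinearOrder ι]
  (b : HilbertBasis ι ℂ H) {K : Type*} [LinearOrder K] [Fintype K]

/-- The projection onto the vacuum, written with the modes of the orthonormal basis `w` of a
finite-dimensional one-particle space as the alternating sum
`∑ S, (-1)^|S| a*(w_{k₁}) ⋯ a*(w_{kₙ}) a(w_{kₙ}) ⋯ a(w_{k₁})`. -/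
noncomputable def vacuumProj (w : OrthonormalBasis K ℂ H) : carAlgebra b :=
  ∑ S : Finset K, ((-1) ^ S.card : ℂ) • (creationProd b w S * star (creationProd b w S))

theorem coe_sum_carAlgebra {J : Type*} (s : Finset J) (x : J → carAlgebra b) :
    ((∑ j ∈ s, x j : carAlgebra b) : FockSpace ι →L[ℂ] FockSpace ι) = ∑ j ∈ s,
      (x j : FockSpace ι →L[ℂ] FockSpace ι) :=
  AddSubmonoidClass.coe_finsetSum _ _

variable (w : OrthonormalBasis K ℂ H)

theorem vacuumProj_apply (ψ : FockSpace ι) :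
    (vacuumProj b w : FockSpace ι →L[ℂ] FockSpace ι) ψ = ⟪vacuum ι, ψ⟫_ℂ • vacuum ι := by
  suffices h : (vacuumProj b w : FockSpace ι →L[ℂ] FockSpace ι) =
      (innerSL ℂ (vacuum ι)).smulRight (vacuum ι) by rw [h]; rfl
  refine ext_occupation b w fun R => ?_
  have h1 : ∀ S : Finset K, ((((-1) ^ S.card : ℂ) • (creationProd b w S *
      star (creationProd b w S)) : carAlgebra b) : FockSpace ι →L[ℂ] FockSpace ι)
        (occupation b w R) =
      if S ∈ R.powerset then ((-1) ^ S.card : ℂ) • occupation b w R else 0 := fun S => by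
    refine (congrArg (fun φ : FockSpace ι => ((-1) ^ S.card : ℂ) • φ)
      (creationProd_mul_star_occupation b w S R)).trans ?_
    simp only [Finset.mem_powerset, smul_ite, smul_zero]
  rw [vacuumProj, coe_sum_carAlgebra, sum_apply]
  simp_rw [h1]
  rw [← Finset.sum_filter, Finset.filter_mem_eq_inter, Finset.univ_inter, ← Finset.sum_smul]
  have h2 : ∑ S ∈ R.powerset, ((-1) ^ S.card : ℂ) = if R = ∅ then 1 else 0 := by
    have h3 := congrArg (Int.cast : ℤ → ℂ) (Finset.sum_powerset_neg_one_pow_card (x := R))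
    push_cast at h3
    exact h3
  rw [h2, ContinuousLinearMap.smulRight_apply, innerSL_apply_apply, inner_vacuum_occupation]
  split_ifs with hR
  · rw [hR, occupation_empty]
  · rw [zero_smul, zero_smul]

/-- Every element of the algebra over a finite-dimensional space is a combination of the matrix
units `|w_T⟩⟨w_T'|`, which are products of creators, the vacuum projection and annihilators. -/
theorem eq_sum_matrixUnits (y : carAlgebra b) :
    y = ∑ T : Finset K, ∑ T' : Finset K,
      ⟪occupation b w T, (y : FockSpace ι →L[ℂ] FockSpace ι) (occupation b w T')⟫_ℂ •
        (creationProd b w T * vacuumProj b w * star (creationProd b w T')) := by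
  let c : Finset K → Finset K → ℂ := fun T T' =>
    ⟪occupation b w T, (y : FockSpace ι →L[ℂ] FockSpace ι) (occupation b w T')⟫_ℂ
  refine Subtype.ext (ext_occupation b w fun R => ?_)
  have h1 : ∀ T T' : Finset K, ((creationProd b w T * vacuumProj b w * star (creationProd b w T') :
      carAlgebra b) : FockSpace ι →L[ℂ] FockSpace ι) (occupation b w R) =
      if T' = R then occupation b w T else 0 := fun T T' => by
    change (creationProd b w T : FockSpace ι →L[ℂ] FockSpace ι)
      ((vacuumProj b w : FockSpace ι →L[ℂ] FockSpace ι)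
        (star (creationProd b w T' : FockSpace ι →L[ℂ] FockSpace ι) (occupation b w R))) = _
    rw [vacuumProj_apply, map_smul, ← inner_occupation, inner_occupation_occupation]
    split_ifs
    · rw [one_smul]; rfl
    · rw [zero_smul]
  have h2 := (occupationBasis b w).sum_repr'
    ((y : FockSpace ι →L[ℂ] FockSpace ι) (occupation b w R))
  simp only [occupationBasis_apply] at h2
  rw [coe_sum_carAlgebra, sum_apply]
  conv_lhs => rw [← h2]
  refine Finset.sum_congr rfl fun T _ => ?_
  rw [coe_sum_carAlgebra, sum_apply, Finset.sum_eq_single R]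
  · refine Eq.symm ((congrArg (fun φ : FockSpace ι => c T R • φ) (h1 T R)).trans ?_)
    rw [if_pos rfl]
  · intro T' _ hT'
    refine (congrArg (fun φ : FockSpace ι => c T T' • φ) (h1 T T')).trans ?_
    rw [if_neg hT', smul_zero]
  · exact fun h => absurd (Finset.mem_univ R) h

variable {b} {κ : ℝ} {ω : carAlgebra b →ₗ[ℂ] ℂ}

theorem map_matrixUnit (hω : IsQuasiFreeState b ((κ : ℂ) • 1) ω) (T T' : Finset K) :
    ω (creationProd b w T * vacuumProj b w * star (creationProd b w T')) =
      if T = T' then (κ : ℂ) ^ T.card * (1 - κ) ^ Tᶜ.card else 0 := by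
  have e : creationProd b w T * vacuumProj b w * star (creationProd b w T') =
      ∑ S : Finset K, ((-1) ^ S.card : ℂ) • (creationProd b w T * creationProd b w S *
        star (creationProd b w T' * creationProd b w S)) := by
    rw [vacuumProj, Finset.mul_sum, Finset.sum_mul]
    refine Finset.sum_congr rfl fun S _ => ?_
    rw [mul_smul_comm, smul_mul_assoc, star_mul]
    simp only [mul_assoc]
  rw [e, map_sum]
  simp_rw [map_smul, map_creationProd_mul_star hω w.orthonormal, smul_eq_mul]
  by_cases hT : T = T'
  · simp only [hT, true_and, if_true, mul_ite, mul_zero]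
    rw [← Finset.sum_filter]
    have h1 : Finset.univ.filter (fun S => Disjoint S T') = T'ᶜ.powerset := by
      ext S; simp [Finset.subset_compl_iff_disjoint_right]
    rw [h1]
    have h2 := Finset.sum_pow_mul_eq_add_pow (-(κ : ℂ)) 1 T'ᶜ
    rw [show (1 : ℂ) - κ = -(κ : ℂ) + 1 by ring, ← h2, Finset.mul_sum]
    refine Finset.sum_congr rfl fun S _ => ?_
    rw [one_pow, mul_one, neg_pow (κ : ℂ), pow_add]
    ring
  · simp [hT]

/-- Over a finite-dimensional one-particle space the quasi-free state with symbol `κ` is given by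
the density matrix `κ^N (1-κ)^(d-N)`, with `N` the particle number. -/
theorem IsQuasiFreeState.apply_eq_sum (hω : IsQuasiFreeState b ((κ : ℂ) • 1) ω)
    (y : carAlgebra b) :
    ω y = ∑ T : Finset K, (κ : ℂ) ^ T.card * (1 - κ) ^ Tᶜ.card *
      ⟪occupation b w T, (y : FockSpace ι →L[ℂ] FockSpace ι) (occupation b w T)⟫_ℂ := by
  conv_lhs => rw [eq_sum_matrixUnits b w y]
  simp_rw [map_sum, map_smul, map_matrixUnit w hω, smul_eq_mul, mul_ite, mul_zero]
  refine Finset.sum_congr rfl fun T _ => ?_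
  rw [Finset.sum_ite_eq, if_pos (Finset.mem_univ T), mul_comm]

end Vacuum

/-! ### Singular values -/

section SingularValues

/-- The singular value decomposition of an operator on a finite-dimensional space. -/
theorem exists_singular_bases {H : Type*} [NormedAddCommGroup H] [InnerProductSpace ℂ H]
    [CompleteSpace H] [FiniteDimensional ℂ H] (V : H →L[ℂ] H) :
    ∃ (f w : OrthonormalBasis (Fin (Module.finrank ℂ H)) ℂ H)
      (v : Fin (Module.finrank ℂ H) → ℝ), ∀ k, V (f k) = (v k : ℂ) • w k := by
  have hsym : (star V * V).toLinearMap.IsSymmetric := (IsSelfAdjoint.star_mul_self V).isSymmetric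
  set f := hsym.eigenvectorBasis rfl with hf
  have horth : ∀ k l, k ≠ l → ⟪V (f k), V (f l)⟫_ℂ = 0 := fun k l hkl => by
    have h1 : ⟪V (f k), V (f l)⟫_ℂ = ⟪f k, (star V * V) (f l)⟫_ℂ := by
      rw [mul_apply_eq_comp, inner_apply_star]
    have h2 := hsym.apply_eigenvectorBasis rfl l
    rw [h1]
    refine (congrArg (fun z => ⟪f k, z⟫_ℂ) h2).trans ?_
    rw [inner_smul_right]
    exact mul_eq_zero_of_right _ (f.orthonormal.2 hkl)
  let u : Fin (Module.finrank ℂ H) → H := fun k => ((‖V (f k)‖⁻¹ : ℝ) : ℂ) • V (f k)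
  have hu : Orthonormal ℂ (({k | V (f k) ≠ 0} : Set _).domRestrict u) := by
    refine ⟨fun k => ?_, fun k l hkl => ?_⟩
    · have hk : ‖V (f k)‖ ≠ 0 := norm_ne_zero_iff.2 k.2
      change ‖((‖V (f k)‖⁻¹ : ℝ) : ℂ) • V (f k)‖ = 1
      rw [norm_smul, Complex.norm_real, norm_inv, norm_norm, inv_mul_cancel₀ hk]
    · change ⟪((‖V (f k)‖⁻¹ : ℝ) : ℂ) • V (f k), ((‖V (f l)‖⁻¹ : ℝ) : ℂ) • V (f l)⟫_ℂ = 0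
      rw [inner_smul_left, inner_smul_right, horth _ _ fun h => hkl (Subtype.ext h), mul_zero,
        mul_zero]
  obtain ⟨w, hw⟩ := hu.exists_orthonormalBasis_extension_of_card_eq (by simp)
  refine ⟨f, w, fun k => ‖V (f k)‖, fun k => ?_⟩
  by_cases hk : V (f k) = 0
  · simp [hk]
  · rw [hw k hk, smul_smul, ← Complex.ofReal_mul, mul_inv_cancel₀ (norm_ne_zero_iff.2 hk),
      Complex.ofReal_one, one_smul]

end SingularValues

/-! ### The spectrum of the correlation matrix in finite dimension -/

section Spectrum

variable {H : Type*} [NormedAddCommGroup H] [InnerProductSpace ℂ H] {ι : Type*} [LinearOrder ι]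
  {b : HilbertBasis ι ℂ H} [CompleteSpace H] {J : Type*} [Fintype J] {x : J → carAlgebra b}
  {V : H →L[ℂ] H} {K : Type*} [LinearOrder K] [Fintype K]

/-- The amplitude `⟨Ω, x_j w_R⟩` with which the Kraus operator `x_j` absorbs all the particles
of the occupation number vector `w_R`. -/
noncomputable def absorption (w : K → H) (x : J → carAlgebra b) (R : Finset K) (j : J) : ℂ :=
  ⟪vacuum ι, (x j : FockSpace ι →L[ℂ] FockSpace ι) (occupation b w R)⟫_ℂ

omit [CompleteSpace H] in
theorem star_fockAnnihilation_real_smul (r : ℝ) (g : H) :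
    star (fockAnnihilation b ((r : ℂ) • g)) = (r : ℂ) • star (fockAnnihilation b g) := by
  rw [fockAnnihilation_smul, star_smul]
  simp

variable {f w : OrthonormalBasis K ℂ H} {v : K → ℝ}

theorem star_kraus_occupation (hx : IsOperationalPartition x)
    (hV : IsQuasiFreeMap b V (partitionMap x)) (hvw : ∀ k, V (f k) = (v k : ℂ) • w k) (j : J)
    (S : Finset K) :
    star (x j : FockSpace ι →L[ℂ] FockSpace ι) (occupation b f S) =
      (∏ k ∈ S, (v k : ℂ)) • (creationProd b w S : FockSpace ι →L[ℂ] FockSpace ι)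
        (star (x j : FockSpace ι →L[ℂ] FockSpace ι) (vacuum ι)) := by
  induction S using Finset.induction_on_min with
  | empty =>
    rw [occupation_empty, creationProd_empty, Finset.prod_empty, one_smul]
    rfl
  | insert a S ha ih =>
    have haS : a ∉ S := fun h => lt_irrefl _ (ha a h)
    have h1 := congrArg (fun y : carAlgebra b => star (y : FockSpace ι →L[ℂ] FockSpace ι))
      (annihilation_mul_kraus hx hV (f a) j)
    have h2 : star (x j : FockSpace ι →L[ℂ] FockSpace ι) * star (fockAnnihilation b (f a)) =
        star (fockAnnihilation b (V (f a))) * star (x j : FockSpace ι →L[ℂ] FockSpace ι) := by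
      rw [← star_mul, ← star_mul]; exact h1
    have h3 := congrArg (fun B : FockSpace ι →L[ℂ] FockSpace ι => B (occupation b f S)) h2
    simp only [mul_apply_eq_comp] at h3
    rw [occupation_insert b ha, h3, ih, hvw, star_fockAnnihilation_real_smul, smul_apply, map_smul,
      smul_smul, Finset.prod_insert haS, creationProd_insert b ha]
    rfl

/-- The matrix elements of the Kraus operators. Going from the occupation number vector `w_T` of the
left singular vectors to the vector `f_Q` of the right ones, `x_j` keeps the particles in `Q`, each
with amplitude `v_k`, and absorbs the others; `ε Q T` is the fermionic sign. -/
theorem exists_inner_kraus_occupation (hx : IsOperationalPartition x)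
    (hV : IsQuasiFreeMap b V (partitionMap x)) (hvw : ∀ k, V (f k) = (v k : ℂ) • w k) :
    ∃ ε : Finset K → Finset K → ℂ, (∀ S R, (starRingEnd ℂ) (ε S R) * ε S R = 1) ∧
      ∀ j Q T, ⟪occupation b f Q,
        (x j : FockSpace ι →L[ℂ] FockSpace ι) (occupation b w T)⟫_ℂ =
        if Q ⊆ T then (∏ k ∈ Q, (v k : ℂ)) * ε Q T * absorption w x (T \ Q) j else 0 := by
  obtain ⟨ε, h1, h2⟩ := exists_star_creationProd_occupation b w.orthonormal
  refine ⟨ε, h1, fun j Q T => ?_⟩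
  rw [← inner_star_apply, star_kraus_occupation hx hV hvw, inner_smul_left, ← inner_apply_star, h2]
  split_ifs
  · rw [inner_smul_right, inner_star_apply, map_prod, absorption]
    simp only [Complex.conj_ofReal, mul_assoc]
  · rw [inner_zero_right, mul_zero]

/-- The inner products of the vectors `x_i w_T` and `x_j w_T'`, expanded in the occupation number
basis of the right singular vectors. -/
theorem exists_inner_kraus_kraus (hx : IsOperationalPartition x)
    (hV : IsQuasiFreeMap b V (partitionMap x)) (hvw : ∀ k, V (f k) = (v k : ℂ) • w k) :
    ∃ ε : Finset K → Finset K → ℂ, (∀ S R, (starRingEnd ℂ) (ε S R) * ε S R = 1) ∧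
      ∀ i j T T', ⟪(x i : FockSpace ι →L[ℂ] FockSpace ι) (occupation b w T),
        (x j : FockSpace ι →L[ℂ] FockSpace ι) (occupation b w T')⟫_ℂ =
        ∑ Q ∈ (T ∩ T').powerset, (∏ k ∈ Q, (v k : ℂ) ^ 2) *
          ((starRingEnd ℂ) (ε Q T) * ε Q T') *
          ((starRingEnd ℂ) (absorption w x (T \ Q) i) * absorption w x (T' \ Q) j) := by
  obtain ⟨ε, h1, h2⟩ := exists_inner_kraus_occupation hx hV hvw
  refine ⟨ε, h1, fun i j T T' => ?_⟩
  rw [← (occupationBasis b f).sum_inner_mul_inner]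
  simp only [occupationBasis_apply]
  rw [← Finset.sum_subset (Finset.subset_univ (T ∩ T').powerset)]
  · refine Finset.sum_congr rfl fun Q hQ => ?_
    rw [Finset.mem_powerset, Finset.subset_inter_iff] at hQ
    rw [← inner_conj_symm, h2, h2, if_pos hQ.1, if_pos hQ.2, map_mul, map_mul, map_prod,
      Finset.prod_pow]
    simp only [Complex.conj_ofReal]
    ring
  · intro Q _ hQ
    rw [Finset.mem_powerset, Finset.subset_inter_iff, not_and_or] at hQ
    rcases hQ with hQ | hQ
    · rw [← inner_conj_symm, h2, if_neg hQ, map_zero, zero_mul]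
    · rw [h2 j, if_neg hQ, mul_zero]

omit [CompleteSpace H] [Fintype K] in
theorem sum_inner_kraus_kraus (hx : IsOperationalPartition x) (φ ψ : FockSpace ι) :
    ∑ j, ⟪(x j : FockSpace ι →L[ℂ] FockSpace ι) φ,
      (x j : FockSpace ι →L[ℂ] FockSpace ι) ψ⟫_ℂ = ⟪φ, ψ⟫_ℂ := by
  have h1 := congrArg (Subtype.val : carAlgebra b → FockSpace ι →L[ℂ] FockSpace ι) hx
  rw [AddSubmonoidClass.coe_finsetSum] at h1
  have h2 := congrArg (fun B : FockSpace ι →L[ℂ] FockSpace ι => ⟪φ, B ψ⟫_ℂ) h1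
  simp only [sum_apply, inner_sum] at h2
  refine Eq.trans (Finset.sum_congr rfl fun j _ => ?_) h2
  rw [← inner_apply_star]
  rfl

/-- The absorption amplitudes are orthogonal in `ℂ^J`. This comes from `∑ j, x_j* x_j = 1`, by
induction on the number of particles. -/
theorem sum_conj_absorption_mul (hx : IsOperationalPartition x)
    (hV : IsQuasiFreeMap b V (partitionMap x)) (hvw : ∀ k, V (f k) = (v k : ℂ) • w k)
    (T T' : Finset K) :
    ∑ j, (starRingEnd ℂ) (absorption w x T j) * absorption w x T' j =
      if T = T' then ((∏ k ∈ T, (1 - v k ^ 2) : ℝ) : ℂ) else 0 := by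
  obtain ⟨ε, h1, h2⟩ := exists_inner_kraus_kraus hx hV hvw
  induction T using Finset.strongInduction generalizing T' with
  | H T ih =>
    have h3 := sum_inner_kraus_kraus hx (occupation b w T) (occupation b w T')
    rw [inner_occupation_occupation] at h3
    simp_rw [h2] at h3
    rw [Finset.sum_comm] at h3
    simp_rw [← Finset.mul_sum] at h3
    have hmem : ∅ ∈ (T ∩ T').powerset := Finset.empty_mem_powerset _
    rw [← Finset.add_sum_erase _ _ hmem, Finset.prod_empty, one_mul, Finset.sdiff_empty,
      Finset.sdiff_empty] at h3
    have h4 : ∀ Q ∈ ((T ∩ T').powerset).erase ∅, Q ⊆ T ∧ Q ⊆ T' ∧ T \ Q ⊂ T := fun Q hQ => by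
      rw [Finset.mem_erase, Finset.mem_powerset, Finset.subset_inter_iff] at hQ
      exact ⟨hQ.2.1, hQ.2.2, Finset.sdiff_ssubset hQ.2.1 (Finset.nonempty_iff_ne_empty.2 hQ.1)⟩
    by_cases hT : T = T'
    · subst hT
      rw [if_pos rfl] at h3 ⊢
      rw [h1, one_mul, Finset.inter_self] at h3
      have h5 : ∑ Q ∈ T.powerset.erase ∅, (∏ k ∈ Q, (v k : ℂ) ^ 2) *
          ((starRingEnd ℂ) (ε Q T) * ε Q T) *
          ∑ j, (starRingEnd ℂ) (absorption w x (T \ Q) j) * absorption w x (T \ Q) j =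
          ∑ Q ∈ T.powerset.erase ∅, (∏ k ∈ Q, (v k : ℂ) ^ 2) *
            ∏ k ∈ T \ Q, (1 - (v k : ℂ) ^ 2) := by
        refine Finset.sum_congr rfl fun Q hQ => ?_
        rw [ih _ (h4 Q (by rwa [Finset.inter_self])).2.2, if_pos rfl, h1, mul_one]
        push_cast
        rfl
      rw [h5] at h3
      have h6 : ∑ Q ∈ T.powerset, (∏ k ∈ Q, (v k : ℂ) ^ 2) *
          ∏ k ∈ T \ Q, (1 - (v k : ℂ) ^ 2) = 1 := by
        rw [← Finset.prod_add]; simp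
      rw [← Finset.add_sum_erase _ _ (Finset.empty_mem_powerset T), Finset.prod_empty, one_mul,
        Finset.sdiff_empty] at h6
      push_cast
      exact add_right_cancel (h3.trans h6.symm)
    · rw [if_neg hT] at h3 ⊢
      rw [Finset.sum_eq_zero (s := Finset.erase _ _), add_zero, mul_eq_zero] at h3
      · refine h3.resolve_left fun h0 => ?_
        rcases mul_eq_zero.1 h0 with h | h
        · have := h1 ∅ T; rw [h, zero_mul] at this; exact zero_ne_one this
        · have := h1 ∅ T'; rw [h, mul_zero] at this; exact zero_ne_one this
      · intro Q hQ
        rw [ih _ (h4 Q hQ).2.2, if_neg, mul_zero]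
        intro h
        exact hT (by rw [← Finset.sdiff_union_of_subset (h4 Q hQ).1, h,
          Finset.sdiff_union_of_subset (h4 Q hQ).2.1])

variable {κ : ℝ} {ω : carAlgebra b →ₗ[ℂ] ℂ}

theorem correlationMatrix_eq_sum (hω : IsQuasiFreeState b ((κ : ℂ) • 1) ω)
    (hx : IsOperationalPartition x)
    (hV : IsQuasiFreeMap b V (partitionMap x)) (hvw : ∀ k, V (f k) = (v k : ℂ) • w k) (i j : J) :
    correlationMatrix ω x i j = ∑ T : Finset K, (κ : ℂ) ^ T.card * (1 - κ) ^ Tᶜ.card *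
      ∑ Q ∈ T.powerset, (∏ k ∈ Q, (v k : ℂ) ^ 2) *
        ((starRingEnd ℂ) (absorption w x (T \ Q) j) * absorption w x (T \ Q) i) := by
  obtain ⟨ε, h1, h2⟩ := exists_inner_kraus_kraus hx hV hvw
  rw [correlationMatrix, Matrix.of_apply, hω.apply_eq_sum w]
  refine Finset.sum_congr rfl fun T _ => ?_
  congr 1
  have e : ⟪occupation b w T, ((star (x j) * x i : carAlgebra b) :
      FockSpace ι →L[ℂ] FockSpace ι) (occupation b w T)⟫_ℂ =
      ⟪(x j : FockSpace ι →L[ℂ] FockSpace ι) (occupation b w T),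
        (x i : FockSpace ι →L[ℂ] FockSpace ι) (occupation b w T)⟫_ℂ := by
    rw [← inner_apply_star]; rfl
  rw [e, h2, Finset.inter_self]
  refine Finset.sum_congr rfl fun Q _ => ?_
  rw [h1, mul_one]

/-- The absorption amplitudes of `w_R` form an eigenvector of the correlation matrix. Its
eigenvalue is the probability that exactly the modes in `R` are absorbed, when independently of
each other the modes are occupied with probability `κ` and absorbed, if occupied, with
probability `1 - v_k²`. -/
theorem correlationMatrix_mulVec_absorption (hω : IsQuasiFreeState b ((κ : ℂ) • 1) ω)
    (hx : IsOperationalPartition x)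
    (hV : IsQuasiFreeMap b V (partitionMap x)) (hvw : ∀ k, V (f k) = (v k : ℂ) • w k)
    (R : Finset K) :
    (correlationMatrix ω x).mulVec (absorption w x R) =
      (((∏ k ∈ R, κ * (1 - v k ^ 2)) * ∏ k ∈ Rᶜ, (1 - κ * (1 - v k ^ 2)) : ℝ) : ℂ) •
        absorption w x R := by
  ext i
  have h1 : (correlationMatrix ω x).mulVec (absorption w x R) i =
      ∑ T : Finset K, ∑ Q ∈ T.powerset, (κ : ℂ) ^ T.card * (1 - κ) ^ Tᶜ.card *
        (∏ k ∈ Q, (v k : ℂ) ^ 2) * absorption w x (T \ Q) i *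
          ∑ j, (starRingEnd ℂ) (absorption w x (T \ Q) j) * absorption w x R j := by
    simp only [Matrix.mulVec, dotProduct, correlationMatrix_eq_sum hω hx hV hvw, Finset.sum_mul,
      Finset.mul_sum]
    rw [Finset.sum_comm]
    refine Finset.sum_congr rfl fun T _ => ?_
    rw [Finset.sum_comm]
    refine Finset.sum_congr rfl fun Q _ => Finset.sum_congr rfl fun j _ => by ring
  have h2 : ∀ T Q : Finset K, Q ⊆ T → (T \ Q = R ↔ T = R ∪ Q ∧ Disjoint Q R) := by
    intro T Q hQT
    constructor
    · rintro rfl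
      exact ⟨(Finset.sdiff_union_of_subset hQT).symm, Finset.disjoint_sdiff⟩
    · rintro ⟨rfl, hd⟩
      rw [Finset.union_sdiff_right, Finset.sdiff_eq_self_of_disjoint hd.symm]
  have h3 : ∀ T : Finset K, ∑ Q ∈ T.powerset, (κ : ℂ) ^ T.card * (1 - κ) ^ Tᶜ.card *
        (∏ k ∈ Q, (v k : ℂ) ^ 2) * absorption w x (T \ Q) i *
          ∑ j, (starRingEnd ℂ) (absorption w x (T \ Q) j) * absorption w x R j =
      ∑ Q ∈ Rᶜ.powerset, if T = R ∪ Q then (κ : ℂ) ^ T.card * (1 - κ) ^ Tᶜ.card *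
        (∏ k ∈ Q, (v k : ℂ) ^ 2) * absorption w x R i *
          ((∏ k ∈ R, (1 - v k ^ 2) : ℝ) : ℂ) else 0 := by
    intro T
    rw [← Finset.sum_filter]
    symm
    rw [← Finset.sum_subset (s₁ := Rᶜ.powerset.filter fun Q => T = R ∪ Q) (s₂ := T.powerset)]
    · refine Finset.sum_congr rfl fun Q hQ => ?_
      rw [Finset.mem_filter, Finset.mem_powerset, Finset.subset_compl_iff_disjoint_right] at hQ
      have hQT : Q ⊆ T := hQ.2 ▸ Finset.subset_union_right
      rw [(h2 T Q hQT).2 ⟨hQ.2, hQ.1⟩, sum_conj_absorption_mul hx hV hvw, if_pos rfl]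
    · intro Q hQ
      rw [Finset.mem_filter] at hQ
      rw [Finset.mem_powerset, hQ.2]
      exact Finset.subset_union_right
    · intro Q hQ hQ'
      rw [Finset.mem_powerset] at hQ
      rw [Finset.mem_filter, Finset.mem_powerset, Finset.subset_compl_iff_disjoint_right] at hQ'
      rw [sum_conj_absorption_mul hx hV hvw, if_neg, mul_zero]
      exact fun h => hQ' ((h2 T Q hQ).1 h).symm
  rw [h1]
  simp_rw [h3]
  rw [Finset.sum_comm]
  simp only [Finset.sum_ite_eq', Finset.mem_univ, if_true]
  have h4 : ∀ Q ∈ Rᶜ.powerset, (κ : ℂ) ^ (R ∪ Q).card * (1 - κ) ^ (R ∪ Q)ᶜ.card *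
        (∏ k ∈ Q, (v k : ℂ) ^ 2) * absorption w x R i *
          ((∏ k ∈ R, (1 - v k ^ 2) : ℝ) : ℂ) =
      ((∏ k ∈ Q, (κ : ℂ) * v k ^ 2) * ∏ k ∈ Rᶜ \ Q, (1 - (κ : ℂ))) *
        ((κ : ℂ) ^ R.card * ((∏ k ∈ R, (1 - v k ^ 2) : ℝ) : ℂ) * absorption w x R i) := by
    intro Q hQ
    rw [Finset.mem_powerset, Finset.subset_compl_iff_disjoint_right] at hQ
    have e : (R ∪ Q)ᶜ = Rᶜ \ Q := by ext; simp
    rw [e, Finset.card_union_of_disjoint hQ.symm, pow_add, Finset.prod_mul_distrib,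
      Finset.prod_const, Finset.prod_const]
    ring
  rw [Finset.sum_congr rfl h4, ← Finset.sum_mul, ← Finset.prod_add, Pi.smul_apply, smul_eq_mul]
  push_cast
  rw [Finset.prod_mul_distrib, Finset.prod_const]
  have h5 : ∏ k ∈ Rᶜ, ((κ : ℂ) * v k ^ 2 + (1 - κ)) = ∏ k ∈ Rᶜ, (1 - (κ : ℂ) * (1 - v k ^ 2)) :=
    Finset.prod_congr rfl fun k _ => by ring
  rw [h5]
  ring

end Spectrum

/-! ### The entropy bound -/

section EntropyBound

variable {H : Type*} [NormedAddCommGroup H] [InnerProductSpace ℂ H] [CompleteSpace H]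

theorem finiteRankTrace_one_sub_star_mul_self [FiniteDimensional ℂ H] {V : H →L[ℂ] H}
    {K : Type*} [Fintype K] {f w : OrthonormalBasis K ℂ H} {v : K → ℝ}
    (hvw : ∀ k, V (f k) = (v k : ℂ) • w k) :
    finiteRankTrace (1 - star V * V) = ((∑ k, (1 - v k ^ 2) : ℝ) : ℂ) := by
  have h := hasSum_inner_finiteRankTrace f.toHilbertBasis (isSelfAdjoint_one_sub_star_mul_self V)
    inferInstance
  rw [h.unique (hasSum_fintype _), Complex.ofReal_sum]
  refine Finset.sum_congr rfl fun k _ => ?_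
  rw [OrthonormalBasis.coe_toHilbertBasis, inner_one_sub_star_mul_self, hvw, inner_smul_left,
    inner_smul_right, inner_self_eq_norm_sq_to_K, inner_self_eq_norm_sq_to_K, f.orthonormal.1,
    w.orthonormal.1, Complex.conj_ofReal]
  push_cast
  simp [sq]

theorem singularValue_sq_le_one {V : H →L[ℂ] H} (hV : star V * V ≤ 1) {K : Type*}
    [Fintype K] {f w : OrthonormalBasis K ℂ H} {v : K → ℝ}
    (hvw : ∀ k, V (f k) = (v k : ℂ) • w k) (k : K) : v k ^ 2 ≤ 1 := by
  have h := ((ContinuousLinearMap.le_def _ _).1 hV).re_inner_nonneg_right (f k)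
  rw [inner_one_sub_star_mul_self, hvw, inner_smul_left, inner_smul_right,
    inner_self_eq_norm_sq_to_K, inner_self_eq_norm_sq_to_K, f.orthonormal.1, w.orthonormal.1,
    Complex.conj_ofReal] at h
  have e : ((1 - v k ^ 2 : ℝ) : ℂ) = (RCLike.ofReal (1 : ℝ) : ℂ) ^ 2 -
      (v k : ℂ) * ((v k : ℂ) * (RCLike.ofReal (1 : ℝ) : ℂ) ^ 2) := by
    push_cast; simp [sq]
  rw [← e] at h
  have h2 : (0 : ℝ) ≤ 1 - v k ^ 2 := h
  linarith

variable {ι : Type*} [LinearOrder ι] {b : HilbertBasis ι ℂ H} {J : Type*} [Fintype J]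
  [DecidableEq J] {x : J → carAlgebra b} {V : H →L[ℂ] H} {κ : ℝ} {ω : carAlgebra b →ₗ[ℂ] ℂ}

/-- The entropy of a partition whose completely positive map is a quasi-free local trap is at
least the entropy of `κ`, per absorbed mode. -/
theorem mul_finiteRankTrace_le_partitionEntropy (hκ₀ : 0 ≤ κ) (hκ₁ : κ ≤ 1)
    (hω : IsQuasiFreeState b ((κ : ℂ) • 1) ω) (hx : IsOperationalPartition x)
    (hV : IsQuasiFreeMap b V (partitionMap x))
    (hfin : FiniteDimensional ℂ (1 - star V * V).toLinearMap.range) :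
    (Real.negMulLog κ + Real.negMulLog (1 - κ)) * (finiteRankTrace (1 - star V * V)).re ≤
      partitionEntropy hω.toIsState x := by
  by_cases hH : FiniteDimensional ℂ H
  · obtain ⟨f, w, v, hvw⟩ := exists_singular_bases V
    have hv := singularValue_sq_le_one hV.star_mul_self_le_one hvw
    rw [finiteRankTrace_one_sub_star_mul_self hvw, Complex.ofReal_re, Finset.mul_sum]
    set p : Fin (Module.finrank ℂ H) → ℝ := fun k => κ * (1 - v k ^ 2) with hp
    calc ∑ k, (Real.negMulLog κ + Real.negMulLog (1 - κ)) * (1 - v k ^ 2)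
        ≤ ∑ k, (Real.negMulLog (p k) + Real.negMulLog (1 - p k)) :=
          Finset.sum_le_sum fun k _ => by
            rw [mul_comm]
            exact mul_binEntropy_le hκ₀ hκ₁ (by linarith [hv k]) (by linarith [sq_nonneg (v k)])
      _ = ∑ R : Finset (Fin (Module.finrank ℂ H)),
            Real.negMulLog ((∏ k ∈ R, p k) * ∏ k ∈ Rᶜ, (1 - p k)) := by
          rw [← sum_negMulLog_prod, Finset.powerset_univ]
          rfl
      _ ≤ _ := sum_negMulLog_le_of_orthogonal _
          (hω.toIsState.eigenvalues_correlationMatrix_mem_Icc hx)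
          (sum_conj_absorption_mul hx hV hvw) _
          (correlationMatrix_mulVec_absorption hω hx hV hvw) fun R hR => by
            rw [hp, Finset.prod_mul_distrib, hR, mul_zero, zero_mul]
  · rw [one_sub_star_mul_self_eq_zero hx hV hfin hH]
    have h0 : finiteRankTrace (0 : H →L[ℂ] H) = 0 := by
      have hs : Subsingleton ((0 : H →L[ℂ] H).toLinearMap.range) := by
        rw [ContinuousLinearMap.toLinearMap_zero, LinearMap.range_zero]
        infer_instance
      rw [finiteRankTrace, Subsingleton.elim (LinearMap.restrict _ _) 0, map_zero]
    rw [h0, Complex.zero_re, mul_zero]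
    exact hω.toIsState.partitionEntropy_nonneg hx

end EntropyBound

end Fermion

open Fermion in
theorem proposition2 {H : Type*} [NormedAddCommGroup H] [InnerProductSpace ℂ H] [CompleteSpace H]
    {ι : Type*} [LinearOrder ι] (b : HilbertBasis ι ℂ H)
    (U : unitary (H →L[ℂ] H)) (Θ : carAlgebra b ≃⋆ₐ[ℂ] carAlgebra b)
    (hΘ : ∀ f : H, Θ (annihilation b f) = annihilation b ((U : H →L[ℂ] H) f))
    (κ : ℝ) (hκ₀ : 0 ≤ κ) (hκ₁ : κ ≤ 1)
    (ω : carAlgebra b →ₗ[ℂ] ℂ) (hω : IsQuasiFreeState b ((κ : ℂ) • 1) ω)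
    (n : ℕ) (x : Fin n → carAlgebra b) (hx : IsOperationalPartition x)
    (V : H →L[ℂ] H) (hV : IsQuasiFreeMap b V (partitionMap x))
    (hloc : FiniteDimensional ℂ (1 - star V * V).toLinearMap.range) (t : ℕ) :
    IsOperationalPartition (refinement Θ x t) ∧
    IsQuasiFreeMap b (trapOperator U V t) (partitionMap (refinement Θ x t)) ∧
    FiniteDimensional ℂ
      (1 - star (trapOperator U V t) * trapOperator U V t).toLinearMap.range ∧
    HasSum
      (fun i => ω (star (annihilation b (b i)) * annihilation b (b i) -
        partitionMap (refinement Θ x t) (star (annihilation b (b i)) * annihilation b (b i))))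
      (κ * finiteRankTrace (1 - star (trapOperator U V t) * trapOperator U V t)) ∧
    (Real.negMulLog κ + Real.negMulLog (1 - κ)) *
        (finiteRankTrace (1 - star (trapOperator U V t) * trapOperator U V t)).re ≤
      partitionEntropy hω.toIsState (refinement Θ x t) := by
  have h1 := isOperationalPartition_refinement Θ hx t
  have h2 := isQuasiFreeMap_refinement hΘ hV t
  have h3 := finiteDimensional_range_trapOperator U hloc t
  exact ⟨h1, h2, h3, hasSum_absorbed hω h2 h3,
    mul_finiteRankTrace_le_partitionEntropy hκ₀ hκ₁ hω h1 h2 h3⟩
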